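/- Let $W$ be a Coxeter group with generating set $S$ and Bruhat order $\le$, let $\mathsf w=\mathsf w_1\cdots\mathsf w_p$ be a reduced expression for $w\in W$, and let $y\le w$. Definitions. For a binary vector (mask) $\nu=(\nu_1,\dots,\nu_p)$ put $\mathsf w^{\nu[j]}=\mathsf w_1^{\nu_1}\cdots \mathsf w_j^{\nu_j}$ and $\mathsf w^\nu=\mathsf w^{\nu[p]}$. Position $j$ is a defect of $\nu$ if $\mathsf w^{\nu[j-1]}\mathsf w_j<\mathsf w^{\nu[j-1]}$; a mask without defects is a constant mask for the element $\mathsf w^\nu$. The same terms are used for masks on a subexpression $\mathsf w^\tau$ of $\mathsf w$ (the word formed by the factors $\mathsf w_j$ with $\tau_j=1$). For a vector $\sigma\in\{X,0,1\}^p$, its $X$-mask $\tau=\Xi(\sigma)$ has $\tau_j=0$ if and only if $\sigma_j=X$, and $\mathsf w^{\sigma[j]}$ is the product of those $\mathsf w_i$ with $i\le j$ and $\sigma_i=1$; position $j$ is a defect of $\sigma$ if $\mathsf w^{\sigma[j-1]}\mathsf w_j<\mathsf w^{\sigma[j-1]}$, and a shifted descent of $\sigma$ if $\mathsf w^{\tau[j-1]}\ge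 \mathsf w^{\sigma[j]}$. The vector $\sigma$ is a relative mask for $y$ if $\tau$ is a constant mask on $\mathsf w$ and the entries of $\sigma$ different from $X$ form a constant mask for $y$ on the subexpression $\mathsf w^{\tau}$. The map $\varphi$. Given a relative mask $\sigma$ for $y$ with $X$-mask $\tau$, find the rightmost position $j$ where one of the following conditions holds, and apply the given change, leaving all entries that are not mentioned as they are: (1) if $\sigma_j=X$ and $j$ is not a defect of $\sigma$, change $\sigma_j$ to $0$; (2) if $\sigma_j=0$, change $\sigma_j$ to $X$; (3) if $\sigma_j=X$ and $j$ is a defect of $\sigma$, replace the $0$ and $1$ entries to the left of $j$ by the constant mask for $\mathsf w^{\sigma[j-1]}\mathsf w_j$ on $\mathsf w^{\tau[j-1]}$, and set $\sigma_j$ to $1$; (4) if $\sigma_j=1$ and $j$ is a shifted descent of $\sigma$, replace the $0$ and $1$ entries to the left of $j$ by the constant mask for $\mathsf w^{\sigma[j]}$ on $\mathsf w^{\tau[j-1]}$, and set $\sigma_j$ to $X$. The result is $\varphi(\sigma)$; if no condition holds at any position, put $\varphi(\sigma)=\sigma$. Theorem. (a) The map $\sigma\mapsto \mathsf w^{\Xi(\sigma)}$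 is a bijection from the set of relative masks for $y$ on $\mathsf w$ onto the Bruhat interval $[y,w]$. (b) The map $\varphi$ is well defined (the constant masks required in (3) and (4) exist and are unique) and is an involution on the set of relative masks for $y$. (c) Suppose $y<w$. Then for every relative mask $\sigma$ for $y$ one of the conditions (1)-(4) holds at some position, and there is exactly one position at which one of $\sigma$, $\varphi(\sigma)$ has the entry $X$ and the other one has an entry $0$ or $1$. Moreover, the edges joining $\mathsf w^{\Xi(\sigma)}$ and $\mathsf w^{\Xi(\varphi(\sigma))}$, for $\sigma$ a relative mask for $y$, form a complete (perfect) matching of the Hasse diagram of the Bruhat order on $[y,w]$. -/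

import Mathlib

/-- The possible entries of a relative mask. -/
inductive MaskEntry where
  | X : MaskEntry
  | zero : MaskEntry
  | one : MaskEntry

/-- `true` exactly on the entry `1`. -/
def MaskEntry.isOne : MaskEntry → Bool
  | .X => false
  | .zero => false
  | .one => true

/-- `true` exactly on the entries `0` and `1`. -/
def MaskEntry.notX : MaskEntry → Bool
  | .X => false
  | .zero => true
  | .one => true

namespace CoxeterSystem

section

variable {B W : Type*} [Group W] {M : CoxeterMatrix B} (cs : CoxeterSystem M W)

/-- Bruhat order: some reduced expression for `u` is a (not necessarily consecutive) subword of
some reduced expression for `v`. -/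
def BruhatLE (u v : W) : Prop :=
  ∃ μ ω : List B, cs.IsReduced μ ∧ cs.wordProd μ = u ∧ cs.IsReduced ω ∧ cs.wordProd ω = v ∧
    List.Sublist μ ω

/-- Strict Bruhat order. -/
def BruhatLT (u v : W) : Prop := cs.BruhatLE u v ∧ u ≠ v

/-- The Bruhat interval `[y, w]`. -/
def bruhatInterval (y w : W) : Set W := {x | cs.BruhatLE y x ∧ cs.BruhatLE x w}

/-- `b` covers `a` in the poset `[y, w]`. -/
def BruhatCovers (y w : W) (a b : cs.bruhatInterval y w) : Prop :=
  cs.BruhatLT a b ∧ ¬ ∃ c : cs.bruhatInterval y w, cs.BruhatLT a c ∧ cs.BruhatLT c b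

/-- The Hasse diagram of the Bruhat interval `[y, w]`, as an undirected graph. -/
def bruhatHasse (y w : W) : SimpleGraph (cs.bruhatInterval y w) where
  Adj a b := cs.BruhatCovers y w a b ∨ cs.BruhatCovers y w b a
  symm := ⟨fun _ _ h => h.symm⟩
  loopless := ⟨fun _ h => h.elim (fun h => h.1.2 rfl) (fun h => h.1.2 rfl)⟩

/-- For a mask `m` on the expression `ω`, the element given by the first `k` factors of `ω` with
the factors at the positions of mask-value `0` omitted. Positions are counted from `0`. -/
def maskProd (ω : List B) (m : Fin ω.length → Bool) (k : ℕ) : W :=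
  (((List.finRange ω.length).take k).map fun i => if m i = true then cs.simple (ω.get i) else 1).prod

/-- Position `j` is a defect with respect to the mask `m` on `ω`. -/
def IsDefect (ω : List B) (m : Fin ω.length → Bool) (j : Fin ω.length) : Prop :=
  cs.BruhatLT (cs.maskProd ω m j * cs.simple (ω.get j)) (cs.maskProd ω m j)

/-- `m` is a constant mask on `ω` for the element `x`. -/
def IsConstantMask (ω : List B) (m : Fin ω.length → Bool) (x : W) : Prop :=
  (∀ j, ¬ cs.IsDefect ω m j) ∧ cs.maskProd ω m ω.length = x

/-- Let `τ` be a mask on `ω` and consider the expression formed by those of the first `k` factors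
of `ω` that `τ` selects. The mask `ν` restricts to a constant mask on this expression for the
element `x` (and is `0` at those of the first `k` positions that `τ` does not select). -/
def IsConstantMaskOn (ω : List B) (τ : Fin ω.length → Bool) (k : ℕ) (ν : Fin ω.length → Bool)
    (x : W) : Prop :=
  (∀ i : Fin ω.length, (i : ℕ) < k → ν i = true → τ i = true) ∧
  (∀ i : Fin ω.length, (i : ℕ) < k → τ i = true → ¬ cs.IsDefect ω ν i) ∧
  cs.maskProd ω ν k = x

end

end CoxeterSystem

/-- The `X`-mask of a vector with entries `X`, `0`, `1`: it is `0` exactly at the `X`-entries. -/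
def xMask {p : ℕ} (σ : Fin p → MaskEntry) : Fin p → Bool := fun i => (σ i).notX

/-- The positions of the entries `1`. -/
def oneMask {p : ℕ} (σ : Fin p → MaskEntry) : Fin p → Bool := fun i => (σ i).isOne

namespace CoxeterSystem

section

variable {B W : Type*} [Group W] {M : CoxeterMatrix B} (cs : CoxeterSystem M W)

/-- The element of `W` given by the `X`-mask of `σ`. -/
def maskTop (ω : List B) (σ : Fin ω.length → MaskEntry) : W :=
  cs.maskProd ω (xMask σ) ω.length

/-- `σ` is a relative mask for `y` on `ω`, encoding `x = maskTop ω σ`: its `X`-mask `τ` is the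
constant mask on `ω` for `x`, and its other entries form the constant mask for `y` on the
subexpression of `ω` selected by `τ`. -/
def IsRelativeMask (ω : List B) (y : W) (σ : Fin ω.length → MaskEntry) : Prop :=
  cs.IsConstantMask ω (xMask σ) (cs.maskTop ω σ) ∧
  cs.IsConstantMaskOn ω (xMask σ) ω.length (oneMask σ) y

/-- Position `j` is a shifted descent: the element given by the `X`-mask on the positions before
`j` is above the element given by `σ` on the positions up to and including `j`. -/
def IsShiftedDescent (ω : List B) (σ : Fin ω.length → MaskEntry) (j : Fin ω.length) : Prop :=
  cs.BruhatLE (cs.maskProd ω (oneMask σ) (j + 1)) (cs.maskProd ω (xMask σ) j)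

/-- Condition of rule (1). -/
def Cond1 (ω : List B) (σ : Fin ω.length → MaskEntry) (j : Fin ω.length) : Prop :=
  σ j = .X ∧ ¬ cs.IsDefect ω (oneMask σ) j

/-- Condition of rule (2). -/
def Cond2 (ω : List B) (σ : Fin ω.length → MaskEntry) (j : Fin ω.length) : Prop :=
  σ j = .zero

/-- Condition of rule (3). -/
def Cond3 (ω : List B) (σ : Fin ω.length → MaskEntry) (j : Fin ω.length) : Prop :=
  σ j = .X ∧ cs.IsDefect ω (oneMask σ) j

/-- Condition of rule (4). -/
def Cond4 (ω : List B) (σ : Fin ω.length → MaskEntry) (j : Fin ω.length) : Prop :=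
  σ j = .one ∧ cs.IsShiftedDescent ω σ j

/-- One of the rules applies at position `j`. -/
def RuleApplies (ω : List B) (σ : Fin ω.length → MaskEntry) (j : Fin ω.length) : Prop :=
  cs.Cond1 ω σ j ∨ Cond2 ω σ j ∨ cs.Cond3 ω σ j ∨ cs.Cond4 ω σ j

/-- `σ'` is obtained from `σ` by replacing the entry at `j` by `e`, replacing the `0` and `1`
entries before `j` by the constant mask for `u` on the subexpression given by the `X`-mask of `σ`
on the positions before `j`, and keeping all other entries. -/
def ReassignedAt (ω : List B) (σ σ' : Fin ω.length → MaskEntry) (j : Fin ω.length)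
    (e : MaskEntry) (u : W) : Prop :=
  (∀ i, i < j → (σ' i = .X ↔ σ i = .X)) ∧
  cs.IsConstantMaskOn ω (xMask σ) j (oneMask σ') u ∧
  σ' j = e ∧
  (∀ i, j < i → σ' i = σ i)

/-- `σ'` arises from `σ` by the rule whose condition holds at position `j`. -/
def RuleResult (ω : List B) (σ σ' : Fin ω.length → MaskEntry) (j : Fin ω.length) : Prop :=
  (cs.Cond1 ω σ j ∧ σ' = Function.update σ j .zero) ∨
  (Cond2 ω σ j ∧ σ' = Function.update σ j .X) ∨
  (cs.Cond3 ω σ j ∧ cs.ReassignedAt ω σ σ' j .one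
    (cs.maskProd ω (oneMask σ) j * cs.simple (ω.get j))) ∨
  (cs.Cond4 ω σ j ∧ cs.ReassignedAt ω σ σ' j .X (cs.maskProd ω (oneMask σ) (j + 1)))

/-- `σ'` arises from `σ` by the rules at the rightmost position where one of them applies. -/
def IsMatchingMove (ω : List B) (σ σ' : Fin ω.length → MaskEntry) : Prop :=
  ∃ j, cs.RuleApplies ω σ j ∧ (∀ k, j < k → ¬ cs.RuleApplies ω σ k) ∧ cs.RuleResult ω σ σ' j

open Classical in
/-- The map `φ`: the result of the rules at the rightmost applicable position, and `σ` itself if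
there is none. -/
noncomputable def matchingMap (ω : List B) (σ : Fin ω.length → MaskEntry) :
    Fin ω.length → MaskEntry :=
  if h : ∃ σ', cs.IsMatchingMove ω σ σ' then h.choose else σ

end

end CoxeterSystem

/-! For a relative mask `σ` let `T_k` and `O_k` be the products of those of the first `k` factors
that are not `X`, respectively that are `1`. Read from the right, a constant mask is forced: a
selected letter gets the entry `1` exactly when it is a right descent of the element still to be
expressed. This gives uniqueness, and the lifting property gives existence for every element below
the product of the word. Using this twice, for `x` in `w` and for `y` in `x`, proves (a).

Rules (1), (2) and rules (3), (4) undo each other at a fixed position `j`. They switch `X` with a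
non-`X` entry and keep `O_{j+1}`, so only the `X`-mask right of `j` can go wrong. No rule applies
there, which means that all entries are `1` and `O_{i+1} ≰ T_i`. The crux is that `O_{i+1} ≰ T'_i`
still holds for the new mask when `i > j` (`LocalMove.not_bruhatLE`). Together with `O_i ≤ T'_i` it
excludes a defect at `i`; it also says that no rule applies right of `j` afterwards, so the next
move is at `j` again and undoes the first.

If `j` becomes `X`, the crux follows from `T'_i ≤ T_i`. If `j` was `X`, then `T'_i = T_j s_j Q` with
`Q` the letters strictly between `j` and `i`, and `not_bruhatLE_simple_mul_partialProd` applies, an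
induction that cancels left descents of `T_j`.

The elements before and after a move are comparable and their lengths differ by one, so they form a
covering. If no rule applies, all entries are `1` and `y = w`. The facts on Bruhat order rest on the
strong exchange property. -/

namespace CoxeterSystem

variable {B W : Type*} [Group W] {M : CoxeterMatrix B} (cs : CoxeterSystem M W)

/-! ### Signed action and strong exchange -/

open Classical in
/-- The action of a simple reflection on signed group elements. -/
noncomputable def signedConj (i : B) : Equiv.Perm (W × ZMod 2) :=
  Function.Involutive.toPerm
    (fun p => (cs.simple i * p.1 * cs.simple i, p.2 + if p.1 = cs.simple i then 1 else 0)) (by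
      intro p
      have h : cs.simple i * p.1 * cs.simple i = cs.simple i ↔ p.1 = cs.simple i := by
        constructor
        · intro h
          have := congrArg (fun x => cs.simple i * x * cs.simple i) h
          simpa [mul_assoc] using this
        · intro h; simp [h]
      ext1
      · simp [mul_assoc]
      · simp only [h]
        split_ifs <;> simp [add_assoc, CharTwo.add_self_eq_zero])

open Classical in
theorem signedConj_apply (i : B) (p : W × ZMod 2) :
    cs.signedConj i p =
      (cs.simple i * p.1 * cs.simple i, p.2 + if p.1 = cs.simple i then 1 else 0) := rfl

theorem simple_mul_pow_mul (i i' : B) (k : ℕ) :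
    cs.simple i' * (cs.simple i * cs.simple i') ^ k =
      ((cs.simple i * cs.simple i') ^ k)⁻¹ * cs.simple i' := by
  have h : SemiconjBy (cs.simple i') (cs.simple i * cs.simple i') (cs.simple i * cs.simple i')⁻¹ := by
    simp [SemiconjBy, mul_assoc]
  rw [← inv_pow]
  exact (h.pow_right k).eq

-- Each factor `s_i s_{i'}` contributes two possible sign flips, one for each of two consecutive
-- elements of the form `s_{i'} (s_i s_{i'})^j`.
open Classical in
theorem signedConj_mul_pow_apply (i i' : B) (m : ℕ) (p : W × ZMod 2) :
    ((cs.signedConj i * cs.signedConj i') ^ m) p =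
      ((cs.simple i * cs.simple i') ^ m * p.1 * ((cs.simple i * cs.simple i') ^ m)⁻¹,
        p.2 + ∑ j ∈ Finset.range (2 * m),
          if p.1 = cs.simple i' * (cs.simple i * cs.simple i') ^ j then 1 else 0) := by
  induction m with
  | zero => simp
  | succ m ih =>
    have e1 : (cs.simple i * cs.simple i') ^ m * p.1 * ((cs.simple i * cs.simple i') ^ m)⁻¹ =
        cs.simple i' ↔ p.1 = cs.simple i' * (cs.simple i * cs.simple i') ^ (2 * m) := by
      rw [two_mul, pow_add, ← mul_assoc, simple_mul_pow_mul, mul_inv_eq_iff_eq_mul,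
        ← eq_inv_mul_iff_mul_eq, mul_assoc]
    have e2 : cs.simple i' * ((cs.simple i * cs.simple i') ^ m * p.1 *
          ((cs.simple i * cs.simple i') ^ m)⁻¹) * cs.simple i' =
        cs.simple i ↔ p.1 = cs.simple i' * (cs.simple i * cs.simple i') ^ (2 * m + 1) := by
      rw [show 2 * m + 1 = m + (1 + m) by ring, pow_add _ m, ← mul_assoc (cs.simple i') (_ ^ m),
        simple_mul_pow_mul, pow_add, pow_one]
      constructor
      · intro h
        have := congrArg (fun x => ((cs.simple i * cs.simple i') ^ m)⁻¹ * (cs.simple i' * x *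
          cs.simple i') * (cs.simple i * cs.simple i') ^ m) h
        simpa [mul_assoc] using this
      · intro h; rw [h]; simp [mul_assoc]
    rw [pow_succ', Equiv.Perm.mul_apply, ih, Equiv.Perm.mul_apply, signedConj_apply,
      signedConj_apply, show 2 * (m + 1) = 2 * m + 1 + 1 by ring, Finset.sum_range_succ,
      Finset.sum_range_succ]
    simp only [e1, e2]
    ext1
    · simp [pow_succ', mul_assoc]
    · simp [add_assoc]

/-- For `m = M i i'` the sum of `2m` flips splits into two halves that agree because `(s_i s_{i'})^m
= 1`; they cancel modulo 2. -/
theorem isLiftable_signedConj : M.IsLiftable cs.signedConj := by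
  classical
  intro i i'
  ext1 p
  rw [signedConj_mul_pow_apply, two_mul, Finset.sum_range_add]
  simp [pow_add, simple_mul_simple_pow, CharTwo.add_self_eq_zero]

/-- The action of the Coxeter group on signed group elements. -/
noncomputable def signedConjHom : W →* Equiv.Perm (W × ZMod 2) :=
  cs.lift ⟨cs.signedConj, cs.isLiftable_signedConj⟩

theorem signedConjHom_simple (i : B) : cs.signedConjHom (cs.simple i) = cs.signedConj i :=
  cs.lift_apply_simple cs.isLiftable_signedConj i

-- Hence the parity of the number of occurrences of `t` in the right inversion sequence depends only
-- on the element, not on the word.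
open Classical in
theorem signedConjHom_wordProd (ω : List B) (p : W × ZMod 2) :
    cs.signedConjHom (cs.wordProd ω) p =
      (cs.wordProd ω * p.1 * (cs.wordProd ω)⁻¹, p.2 + (cs.rightInvSeq ω).count p.1) := by
  induction ω with
  | nil => simp
  | cons i ω ih =>
    have e : cs.wordProd ω * p.1 * (cs.wordProd ω)⁻¹ = cs.simple i ↔
        (cs.wordProd ω)⁻¹ * cs.simple i * cs.wordProd ω = p.1 := by
      constructor
      · intro h; rw [← h]; group
      · intro h; rw [← h]; group
    rw [wordProd_cons, map_mul, Equiv.Perm.mul_apply, ih, signedConjHom_simple, signedConj_apply,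
      rightInvSeq, List.count_cons]
    simp only [e, beq_iff_eq]
    ext1
    · simp [mul_assoc]
    · push_cast
      simp [add_assoc]

theorem signedConjHom_add (w t : W) (ε : ZMod 2) :
    cs.signedConjHom w (t, ε) =
      ((cs.signedConjHom w (t, 0)).1, (cs.signedConjHom w (t, 0)).2 + ε) := by
  classical
  obtain ⟨ω, rfl⟩ := cs.wordProd_surjective w
  simp [signedConjHom_wordProd, add_comm]

/-- For `t = u s u⁻¹` the signs picked up from `u⁻¹` and `u` cancel; the single flip of `s` at `s`
remains. -/
theorem IsReflection.signedConjHom_self {t : W} (ht : cs.IsReflection t) :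
    cs.signedConjHom t (t, 0) = (t, 1) := by
  classical
  obtain ⟨u, i, rfl⟩ := ht
  obtain ⟨ε, hε⟩ : ∃ ε, cs.signedConjHom u⁻¹ (u * cs.simple i * u⁻¹, 0) = (cs.simple i, ε) := by
    obtain ⟨ω, hω⟩ := cs.wordProd_surjective u⁻¹
    refine ⟨(cs.signedConjHom u⁻¹ (u * cs.simple i * u⁻¹, 0)).2, ?_⟩
    ext1
    · rw [← hω, signedConjHom_wordProd, hω]; simp [mul_assoc]
    · rfl
  have h2 : cs.signedConjHom u (cs.simple i, ε) = (u * cs.simple i * u⁻¹, 0) := by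
    rw [← hε, map_inv]; simp
  rw [map_mul, map_mul, Equiv.Perm.mul_apply, Equiv.Perm.mul_apply, hε, signedConjHom_simple,
    signedConj_apply]
  rw [signedConjHom_add] at h2
  rw [signedConjHom_add]
  simp only [Prod.mk.injEq] at h2
  simp [h2.1, ← add_assoc, h2.2]

/-- The strong exchange property. -/
theorem exists_eraseIdx_of_length_mul_lt (ω : List B) {t : W} (ht : cs.IsReflection t)
    (h : cs.length (cs.wordProd ω * t) < cs.length (cs.wordProd ω)) :
    ∃ k < ω.length, cs.wordProd ω * t = cs.wordProd (ω.eraseIdx k) := by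
  classical
  have hlt : ∀ w : W, (cs.signedConjHom w (t, 0)).2 ≠ 0 →
      cs.length (w * t) < cs.length w := by
    intro w hw
    obtain ⟨μ, hμ, rfl⟩ := cs.exists_isReduced w
    rw [signedConjHom_wordProd] at hw
    have : t ∈ cs.rightInvSeq μ := by
      by_contra hn
      exact hw (by simp [List.count_eq_zero_of_not_mem hn])
    exact (cs.isRightInversion_of_mem_rightInvSeq hμ this).2
  have hmem : t ∈ cs.rightInvSeq ω := by
    by_contra hn
    have h0 : (cs.signedConjHom (cs.wordProd ω) (t, 0)).2 = 0 := by
      rw [signedConjHom_wordProd]; simp [List.count_eq_zero_of_not_mem hn]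
    -- If the parity of `t` is even for `w`, it is odd for `w t`, so that `w t t = w` would be
    -- shorter than `w t`.
    have := hlt (cs.wordProd ω * t) (by
      rw [map_mul, Equiv.Perm.mul_apply, ht.signedConjHom_self, signedConjHom_add, h0]; simp)
    rw [mul_assoc, ht.mul_self, mul_one] at this
    omega
  obtain ⟨k, hk, rfl⟩ := List.getElem_of_mem hmem
  refine ⟨k, by simpa using hk, ?_⟩
  rw [← wordProd_mul_getD_rightInvSeq, List.getD_eq_getElem _ _ hk]

/-- Otherwise strong exchange, for the reflection `s t s` and a reduced word of `u` followed by `s`,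
deletes a letter. Deleting one from `u` makes `u t` shorter than `u`; deleting the last one gives `u
t = u s`. -/
theorem length_mul_simple_lt_of_reflection {u t : W} (ht : cs.IsReflection t)
    (h : cs.length u < cs.length (u * t)) (i : B) (hne : u * t ≠ u * cs.simple i) :
    cs.length (u * cs.simple i) < cs.length (u * t * cs.simple i) := by
  by_contra hcon
  have hr : cs.IsReflection (cs.simple i * t * cs.simple i) := by
    simpa using ht.conj (cs.simple i)
  have e : u * cs.simple i * (cs.simple i * t * cs.simple i) = u * t * cs.simple i := by
    simp [mul_assoc]
  have hne' := hr.length_mul_left_ne (u * cs.simple i)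
  rw [e] at hne'
  obtain ⟨ω, hω, rfl⟩ := cs.exists_isReduced u
  obtain ⟨k, hk, hk'⟩ := cs.exists_eraseIdx_of_length_mul_lt (ω ++ [i]) hr (by
    rw [wordProd_append, wordProd_singleton, e]; omega)
  rw [wordProd_append, wordProd_singleton, e] at hk'
  rcases Nat.lt_or_ge k ω.length with hlt | hge
  · rw [List.eraseIdx_append_of_lt_length hlt, wordProd_append, wordProd_singleton,
      mul_left_inj] at hk'
    have h1 := cs.length_wordProd_le (ω.eraseIdx k)
    rw [← hk', List.length_eraseIdx_of_lt hlt] at h1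
    rw [hω.eq] at h
    omega
  · have hk2 : k = ω.length := by simp at hk; omega
    subst hk2
    rw [List.eraseIdx_append_of_length_le le_rfl] at hk'
    simp only [Nat.sub_self, List.eraseIdx_cons_zero, List.append_nil] at hk'
    apply hne
    conv_rhs => rw [← hk']
    simp

/-! ### Bruhat order by chains of reflections, and the lifting property -/

/-- An edge of the Bruhat graph. -/
def BruhatEdge (u v : W) : Prop :=
  ∃ t, cs.IsReflection t ∧ v = u * t ∧ cs.length u < cs.length v

/-- The order generated by the Bruhat graph. -/
def ReflLE : W → W → Prop := Relation.ReflTransGen cs.BruhatEdge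

theorem bruhatEdge_mul_simple {u : W} {i : B} (h : cs.length u < cs.length (u * cs.simple i)) :
    cs.BruhatEdge u (u * cs.simple i) :=
  ⟨_, cs.isReflection_simple i, rfl, h⟩

variable {cs}

theorem BruhatEdge.mul_simple {u v : W} (h : cs.BruhatEdge u v) (i : B) :
    v = u * cs.simple i ∨ cs.BruhatEdge (u * cs.simple i) (v * cs.simple i) := by
  obtain ⟨t, ht, rfl, hlt⟩ := h
  by_cases hne : u * t = u * cs.simple i
  · exact Or.inl hne
  · refine Or.inr ⟨cs.simple i * t * cs.simple i, by simpa using ht.conj (cs.simple i),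
      by simp [mul_assoc], cs.length_mul_simple_lt_of_reflection ht hlt i hne⟩

theorem ReflLE.length_le {u v : W} (h : cs.ReflLE u v) : cs.length u ≤ cs.length v := by
  induction h with
  | refl => exact le_rfl
  | tail _ h ih => obtain ⟨t, -, -, h⟩ := h; omega

theorem ReflLE.eq_of_length_le {u v : W} (h : cs.ReflLE u v) (hl : cs.length v ≤ cs.length u) :
    u = v := by
  rcases Relation.ReflTransGen.cases_head h with h | ⟨c, hc, h⟩
  · exact h
  · obtain ⟨t, -, -, h'⟩ := hc
    have := ReflLE.length_le h
    omega

theorem ReflLE.mul_simple_of_lt {u v : W} (h : cs.ReflLE u v) {i : B}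
    (hv : cs.length v < cs.length (v * cs.simple i)) :
    cs.ReflLE (u * cs.simple i) (v * cs.simple i) := by
  -- The induction carries a disjunction because a chain step from `b` to `b s` merely exchanges the
  -- two alternatives.
  have key : ∀ z, cs.ReflLE (u * cs.simple i) z ∨ cs.ReflLE (u * cs.simple i) (z * cs.simple i) →
      cs.length z < cs.length (z * cs.simple i) → cs.ReflLE (u * cs.simple i) (z * cs.simple i) := by
    rintro z (hz | hz) hl
    · exact hz.tail (cs.bruhatEdge_mul_simple hl)
    · exact hz
  apply key v _ hv
  clear hv key
  induction h with
  | refl => exact Or.inr .refl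
  | @tail b c _ hbc ih =>
    rcases hbc.mul_simple i with rfl | h
    · simpa [or_comm] using ih
    · rcases ih with ih | ih
      · exact Or.inl (ih.tail hbc)
      · exact Or.inr (ih.tail h)

/-- Source of all lifting properties. Induction from the bottom of the chain: multiplying an edge by
`s` gives an edge again, unless the edge itself is multiplication by `s`. -/
theorem ReflLE.of_mul_simple_of_lt {u v : W} (h : cs.ReflLE u v) {i : B}
    (hv : cs.length (v * cs.simple i) < cs.length v) :
    cs.ReflLE u (v * cs.simple i) ∨
      cs.length (u * cs.simple i) < cs.length u ∧
        cs.ReflLE (u * cs.simple i) (v * cs.simple i) := by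
  induction h using Relation.ReflTransGen.head_induction_on with
  | refl => exact Or.inr ⟨hv, .refl⟩
  | @head a c hac _ ih =>
    rcases hac.mul_simple i with rfl | h
    · rcases ih with ih | ⟨-, ih⟩
      · exact Or.inl (ih.head hac)
      · exact Or.inl (by simpa using ih)
    · rcases ih with ih | ⟨hl, ih⟩
      · exact Or.inl (ih.head hac)
      · have ha : cs.ReflLE (a * cs.simple i) (v * cs.simple i) := ih.head h
        rcases lt_or_gt_of_ne (cs.length_mul_simple_ne a i) with h1 | h1
        · exact Or.inr ⟨h1, ha⟩
        · exact Or.inl (ha.head (cs.bruhatEdge_mul_simple h1))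

theorem reflLE_of_sublist {μ ω : List B} (hω : cs.IsReduced ω) (h : List.Sublist μ ω) :
    cs.ReflLE (cs.wordProd μ) (cs.wordProd ω) := by
  induction ω using List.reverseRecOn generalizing μ with
  | nil => rw [List.sublist_nil.1 h]; exact .refl
  | append_singleton ω i ih =>
    have hω' : cs.IsReduced ω := by simpa using hω.take ω.length
    have hl : cs.length (cs.wordProd ω) < cs.length (cs.wordProd ω * cs.simple i) := by
      have := hω.eq
      rw [wordProd_append, wordProd_singleton] at this
      rw [this, hω'.eq]; simp
    rw [wordProd_append, wordProd_singleton]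
    obtain ⟨μ', ν, rfl, h1, h2⟩ := List.sublist_append_iff.1 h
    rcases List.sublist_singleton.1 h2 with rfl | rfl
    · rw [List.append_nil]
      exact (ih hω' h1).tail (cs.bruhatEdge_mul_simple hl)
    · rw [wordProd_append, wordProd_singleton]
      exact (ih hω' h1).mul_simple_of_lt hl

/-- The two alternatives of lifting decide whether the last letter of `ω` is used in the subword. -/
theorem ReflLE.exists_sublist {u : W} {ω : List B} (hω : cs.IsReduced ω)
    (h : cs.ReflLE u (cs.wordProd ω)) :
    ∃ μ, cs.IsReduced μ ∧ cs.wordProd μ = u ∧ List.Sublist μ ω := by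
  induction ω using List.reverseRecOn generalizing u with
  | nil =>
    refine ⟨[], hω, ?_, List.Sublist.refl _⟩
    exact (h.eq_of_length_le (by simp)).symm
  | append_singleton ω i ih =>
    have hω' : cs.IsReduced ω := by simpa using hω.take ω.length
    have hl : cs.length (cs.wordProd ω) < cs.length (cs.wordProd ω * cs.simple i) := by
      have := hω.eq
      rw [wordProd_append, wordProd_singleton] at this
      rw [this, hω'.eq]; simp
    rw [wordProd_append, wordProd_singleton] at h
    rcases h.of_mul_simple_of_lt (i := i) (by simpa using hl) with h | ⟨h1, h⟩
    · obtain ⟨μ, h1, h2, h3⟩ := ih hω' (by simpa using h)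
      exact ⟨μ, h1, h2, h3.trans (List.sublist_append_left _ _)⟩
    · obtain ⟨μ, h2, h3, h4⟩ := ih hω' (by simpa using h)
      have h5 : cs.wordProd (μ ++ [i]) = u := by
        rw [wordProd_append, wordProd_singleton, h3]; simp
      refine ⟨μ ++ [i], ?_, h5, h4.append (List.Sublist.refl _)⟩
      have h6 := cs.length_mul_simple u i
      rw [IsReduced, h5, List.length_append, ← h2.eq, h3]
      simp; omega

/-- Chains make transitivity evident, which the subword definition does not. -/
theorem bruhatLE_iff_reflLE {u v : W} : cs.BruhatLE u v ↔ cs.ReflLE u v := by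
  constructor
  · rintro ⟨μ, ω, -, rfl, hω, rfl, h⟩
    exact reflLE_of_sublist hω h
  · intro h
    obtain ⟨ω, hω, rfl⟩ := cs.exists_isReduced v
    obtain ⟨μ, h1, h2, h3⟩ := h.exists_sublist hω
    exact ⟨μ, ω, h1, h2, hω, rfl, h3⟩

theorem BruhatLE.refl (u : W) : cs.BruhatLE u u := bruhatLE_iff_reflLE.2 .refl

theorem BruhatLE.trans {u v w : W} (h : cs.BruhatLE u v) (h' : cs.BruhatLE v w) :
    cs.BruhatLE u w := by
  rw [bruhatLE_iff_reflLE] at *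
  exact Relation.ReflTransGen.trans h h'

theorem BruhatLE.length_le {u v : W} (h : cs.BruhatLE u v) : cs.length u ≤ cs.length v :=
  (bruhatLE_iff_reflLE.1 h).length_le

theorem BruhatLE.eq_of_length_le {u v : W} (h : cs.BruhatLE u v)
    (hl : cs.length v ≤ cs.length u) : u = v :=
  (bruhatLE_iff_reflLE.1 h).eq_of_length_le hl

theorem BruhatLT.length_lt {u v : W} (h : cs.BruhatLT u v) : cs.length u < cs.length v := by
  by_contra hn
  exact h.2 (h.1.eq_of_length_le (by omega))

theorem bruhatLE_mul_simple {u : W} {i : B} (h : cs.length u < cs.length (u * cs.simple i)) :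
    cs.BruhatLE u (u * cs.simple i) :=
  bruhatLE_iff_reflLE.2 (.single (cs.bruhatEdge_mul_simple h))

theorem bruhatLT_mul_simple_iff {u : W} {i : B} :
    cs.BruhatLT (u * cs.simple i) u ↔ cs.length (u * cs.simple i) < cs.length u := by
  refine ⟨BruhatLT.length_lt, fun h => ⟨?_, fun e => by rw [e] at h; omega⟩⟩
  simpa using bruhatLE_mul_simple (cs := cs) (u := u * cs.simple i) (i := i) (by simpa using h)

theorem BruhatLE.mul_simple {u v : W} (h : cs.BruhatLE u v) {i : B}
    (hv : cs.length v < cs.length (v * cs.simple i)) :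
    cs.BruhatLE (u * cs.simple i) (v * cs.simple i) :=
  bruhatLE_iff_reflLE.2 ((bruhatLE_iff_reflLE.1 h).mul_simple_of_lt hv)

/-- Lifting property for an ascent of the smaller element. -/
theorem BruhatLE.of_le_mul_simple {u v : W} {i : B} (h : cs.BruhatLE u (v * cs.simple i))
    (hv : cs.length v < cs.length (v * cs.simple i))
    (hu : cs.length u < cs.length (u * cs.simple i)) : cs.BruhatLE u v := by
  rw [bruhatLE_iff_reflLE] at *
  rcases h.of_mul_simple_of_lt (i := i) (by simpa using hv) with h | ⟨h, -⟩
  · simpa using h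
  · omega

/-- Lifting property for a descent of the smaller element. -/
theorem BruhatLE.mul_simple_le {u v : W} {i : B} (h : cs.BruhatLE u (v * cs.simple i))
    (hv : cs.length v < cs.length (v * cs.simple i))
    (hu : cs.length (u * cs.simple i) < cs.length u) : cs.BruhatLE (u * cs.simple i) v := by
  rw [bruhatLE_iff_reflLE] at *
  rcases h.of_mul_simple_of_lt (i := i) (by simpa using hv) with h | ⟨-, h⟩
  · rw [simple_mul_simple_cancel_right] at h
    refine Relation.ReflTransGen.head ?_ h
    simpa using cs.bruhatEdge_mul_simple (u := u * cs.simple i) (i := i) (by simpa using hu)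
  · simpa using h

/-- Reversing words transfers the lifting properties to left multiplication. -/
theorem BruhatLE.inv {u v : W} (h : cs.BruhatLE u v) : cs.BruhatLE u⁻¹ v⁻¹ := by
  obtain ⟨μ, ω, h1, rfl, h2, rfl, h3⟩ := h
  exact ⟨μ.reverse, ω.reverse, h1.reverse, by simp, h2.reverse, by simp,
    h3.reverse⟩

theorem BruhatLE.simple_mul_le_of_lt {u v : W} {i : B} (h : cs.BruhatLE u v)
    (hv : cs.length (cs.simple i * v) < cs.length v)
    (hu : cs.length u < cs.length (cs.simple i * u)) : cs.BruhatLE u (cs.simple i * v) := by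
  have := BruhatLE.of_le_mul_simple (cs := cs) (i := i) (u := u⁻¹) (v := v⁻¹ * cs.simple i)
    (by simpa using h.inv)
    (by rw [← cs.length_inv (v⁻¹ * _), ← cs.length_inv (_ * _)]; simpa using hv)
    (by rw [← cs.length_inv (u⁻¹ * _), cs.length_inv]; simpa using hu)
  simpa using this.inv

theorem BruhatLE.simple_mul_le_simple_mul {u v : W} {i : B} (h : cs.BruhatLE u v)
    (hv : cs.length (cs.simple i * v) < cs.length v)
    (hu : cs.length (cs.simple i * u) < cs.length u) :
    cs.BruhatLE (cs.simple i * u) (cs.simple i * v) := by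
  have := BruhatLE.mul_simple_le (cs := cs) (i := i) (u := u⁻¹) (v := v⁻¹ * cs.simple i)
    (by simpa using h.inv)
    (by rw [← cs.length_inv (v⁻¹ * _), ← cs.length_inv (_ * _)]; simpa using hv)
    (by rw [← cs.length_inv (u⁻¹ * _), cs.length_inv u]; simpa using hu)
  simpa using this.inv

theorem BruhatLE.simple_mul {u v : W} {i : B} (h : cs.BruhatLE u v)
    (hv : cs.length v < cs.length (cs.simple i * v)) :
    cs.BruhatLE (cs.simple i * u) (cs.simple i * v) := by
  have := h.inv.mul_simple (i := i)
    (by rw [← cs.length_inv (v⁻¹ * _), cs.length_inv]; simpa using hv)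
  simpa using this.inv

theorem bruhatLE_simple_mul {u : W} {i : B} (h : cs.length u < cs.length (cs.simple i * u)) :
    cs.BruhatLE u (cs.simple i * u) := by
  have := (bruhatLE_mul_simple (u := u⁻¹) (i := i)
    (by rw [← cs.length_inv (u⁻¹ * _), cs.length_inv]; simpa using h)).inv
  simpa using this

end CoxeterSystem

namespace CoxeterSystem

variable {B W : Type*} [Group W] {M : CoxeterMatrix B} {cs : CoxeterSystem M W}

/-! Masks -/

section

variable {ω : List B}

theorem maskProd_zero (m : Fin ω.length → Bool) : cs.maskProd ω m 0 = 1 := by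
  simp [maskProd]

theorem maskProd_succ (m : Fin ω.length → Bool) (j : Fin ω.length) :
    cs.maskProd ω m (j + 1) =
      cs.maskProd ω m j * if m j = true then cs.simple (ω.get j) else 1 := by
  have h : (j : ℕ) < (List.finRange ω.length).length := by simp
  simp only [maskProd, ← List.take_concat_get' _ _ h, List.map_append, List.prod_append]
  simp

theorem maskProd_congr {m m' : Fin ω.length → Bool} {k : ℕ} (hk : k ≤ ω.length)
    (h : ∀ i : Fin ω.length, (i : ℕ) < k → m i = m' i) :
    cs.maskProd ω m k = cs.maskProd ω m' k := by
  induction k with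
  | zero => simp [maskProd_zero]
  | succ k ih =>
    have h1 := maskProd_succ (cs := cs) m ⟨k, hk⟩
    have h2 := maskProd_succ (cs := cs) m' ⟨k, hk⟩
    simp only at h1 h2
    rw [h1, h2, ih (by omega) (fun i hi => h i (by omega)), h ⟨k, hk⟩ (Nat.lt_succ_self k)]

theorem maskProd_true {k : ℕ} (hk : k ≤ ω.length) :
    cs.maskProd ω (fun _ => true) k = cs.wordProd (ω.take k) := by
  induction k with
  | zero => simp [maskProd_zero]
  | succ k ih =>
    have h1 := maskProd_succ (cs := cs) (fun _ => true) ⟨k, hk⟩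
    simp only at h1
    rw [h1, ih (by omega), List.take_succ_eq_append_getElem (by omega), wordProd_append]
    simp

theorem maskProd_true_length : cs.maskProd ω (fun _ => true) ω.length = cs.wordProd ω := by
  rw [maskProd_true le_rfl, List.take_length]

theorem length_maskProd_true (hω : cs.IsReduced ω) {k : ℕ} (hk : k ≤ ω.length) :
    cs.length (cs.maskProd ω (fun _ => true) k) = k := by
  rw [maskProd_true hk, (hω.take k).eq]
  simpa using hk

theorem isDefect_iff {m : Fin ω.length → Bool} {j : Fin ω.length} :
    cs.IsDefect ω m j ↔
      cs.length (cs.maskProd ω m j * cs.simple (ω.get j)) < cs.length (cs.maskProd ω m j) :=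
  bruhatLT_mul_simple_iff

theorem not_isDefect_iff {m : Fin ω.length → Bool} {j : Fin ω.length} :
    ¬ cs.IsDefect ω m j ↔
      cs.length (cs.maskProd ω m j) < cs.length (cs.maskProd ω m j * cs.simple (ω.get j)) := by
  rw [isDefect_iff]
  have := cs.length_mul_simple_ne (cs.maskProd ω m j) (ω.get j)
  omega

theorem isDefect_congr {m m' : Fin ω.length → Bool} {j : Fin ω.length}
    (h : ∀ i < j, m i = m' i) : cs.IsDefect ω m j ↔ cs.IsDefect ω m' j := by
  rw [isDefect_iff, isDefect_iff, maskProd_congr j.2.le (fun i hi => h i hi)]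

theorem not_isDefect_true (hω : cs.IsReduced ω) (j : Fin ω.length) :
    ¬ cs.IsDefect ω (fun _ => true) j := by
  rw [not_isDefect_iff]
  have h := maskProd_succ (cs := cs) (fun _ => true) j
  simp only [if_true] at h
  rw [← h, length_maskProd_true hω j.2.le, length_maskProd_true hω j.2]
  omega

/-- Every letter selected by `τ` lengthens its product, so the order survives whether `ν` takes that
letter or not; `ν` itself may have defects. -/
theorem maskProd_le_maskProd {τ ν : Fin ω.length → Bool} {k : ℕ} (hk : k ≤ ω.length)
    (hτ : ∀ i : Fin ω.length, (i : ℕ) < k → τ i = true → ¬ cs.IsDefect ω τ i)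
    (h : ∀ i : Fin ω.length, (i : ℕ) < k → ν i = true → τ i = true) :
    cs.BruhatLE (cs.maskProd ω ν k) (cs.maskProd ω τ k) := by
  induction k with
  | zero => rw [maskProd_zero, maskProd_zero]; exact .refl _
  | succ k ih =>
    have h1 := maskProd_succ (cs := cs) ν ⟨k, hk⟩
    have h2 := maskProd_succ (cs := cs) τ ⟨k, hk⟩
    simp only at h1 h2
    have ih := ih (by omega) (fun i hi => hτ i (by omega)) (fun i hi => h i (by omega))
    have h3 := h ⟨k, hk⟩ (Nat.lt_succ_self k)
    have h4 := hτ ⟨k, hk⟩ (Nat.lt_succ_self k)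
    rw [h1, h2]
    cases hτk : τ ⟨k, hk⟩ with
    | false =>
      cases hνk : ν ⟨k, hk⟩ with
      | false => simpa using ih
      | true => rw [h3 hνk] at hτk; cases hτk
    | true =>
      have h4 := not_isDefect_iff.1 (h4 hτk)
      cases hνk : ν ⟨k, hk⟩ with
      | false => simpa using ih.trans (bruhatLE_mul_simple h4)
      | true => simpa using ih.mul_simple h4

theorem IsConstantMaskOn.prefix {τ ν : Fin ω.length → Bool} {k l : ℕ} {x : W}
    (h : cs.IsConstantMaskOn ω τ k ν x) (hl : l ≤ k) :
    cs.IsConstantMaskOn ω τ l ν (cs.maskProd ω ν l) :=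
  ⟨fun i hi => h.1 i (by omega), fun i hi => h.2.1 i (by omega), rfl⟩

/-- The last selected entry is forced by `x` alone; this drives uniqueness. -/
theorem IsConstantMaskOn.apply_last {τ ν : Fin ω.length → Bool} {j : Fin ω.length} {x : W}
    (h : cs.IsConstantMaskOn ω τ (j + 1) ν x) (hτ : τ j = true) :
    ν j = true ↔ cs.length (x * cs.simple (ω.get j)) < cs.length x := by
  have h1 := not_isDefect_iff.1 (h.2.1 j (Nat.lt_succ_self _) hτ)
  have h2 := h.2.2
  rw [maskProd_succ] at h2
  cases hν : ν j with
  | false =>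
    simp only [hν, Bool.false_eq_true, if_false, mul_one] at h2
    rw [h2] at h1
    simp only [Bool.false_eq_true, false_iff]
    omega
  | true =>
    simp only [hν, if_true] at h2
    rw [← h2]
    simpa using h1

theorem IsConstantMaskOn.unique {τ ν ν' : Fin ω.length → Bool} {k : ℕ} {x : W}
    (hk : k ≤ ω.length) (h : cs.IsConstantMaskOn ω τ k ν x)
    (h' : cs.IsConstantMaskOn ω τ k ν' x) (i : Fin ω.length) (hi : (i : ℕ) < k) :
    ν i = ν' i := by
  induction k generalizing x with
  | zero => omega
  | succ k ih =>
    have hj : ν ⟨k, hk⟩ = ν' ⟨k, hk⟩ := by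
      cases hτ : τ ⟨k, hk⟩ with
      | false =>
        have h1 := h.1 ⟨k, hk⟩ (Nat.lt_succ_self k)
        have h2 := h'.1 ⟨k, hk⟩ (Nat.lt_succ_self k)
        simp_all
      | true =>
        exact Bool.eq_iff_iff.2 ((h.apply_last (j := ⟨k, hk⟩) hτ).trans
          (h'.apply_last (j := ⟨k, hk⟩) hτ).symm)
    rcases Nat.lt_succ_iff_lt_or_eq.1 hi with hi | hi
    · have h1 := maskProd_succ (cs := cs) ν ⟨k, hk⟩
      have h2 := maskProd_succ (cs := cs) ν' ⟨k, hk⟩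
      simp only at h1 h2
      rw [h.2.2] at h1
      rw [h'.2.2, h1, hj, mul_left_inj] at h2
      have h3 := h'.prefix (Nat.le_succ k)
      rw [← h2] at h3
      exact ih (by omega) (h.prefix (Nat.le_succ k)) h3 hi
    · obtain rfl : i = ⟨k, hk⟩ := Fin.ext hi
      exact hj

theorem IsConstantMaskOn.congr {τ τ' ν ν' : Fin ω.length → Bool} {k : ℕ} {x : W}
    (hk : k ≤ ω.length) (h : cs.IsConstantMaskOn ω τ k ν x)
    (hτ : ∀ i : Fin ω.length, (i : ℕ) < k → τ i = τ' i)
    (hν : ∀ i : Fin ω.length, (i : ℕ) < k → ν i = ν' i) :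
    cs.IsConstantMaskOn ω τ' k ν' x := by
  refine ⟨fun i hi => by rw [← hτ i hi, ← hν i hi]; exact h.1 i hi, fun i hi h' => ?_, ?_⟩
  · rw [← isDefect_congr (fun l hl => hν l (lt_trans hl hi))]
    exact h.2.1 i hi (by rw [hτ i hi]; exact h')
  · rw [← h.2.2, maskProd_congr hk hν]

theorem exists_isConstantMaskOn {τ : Fin ω.length → Bool} {k : ℕ} (hk : k ≤ ω.length)
    (hτ : ∀ i : Fin ω.length, (i : ℕ) < k → τ i = true → ¬ cs.IsDefect ω τ i) {x : W}
    (hx : cs.BruhatLE x (cs.maskProd ω τ k)) :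
    ∃ ν, cs.IsConstantMaskOn ω τ k ν x := by
  induction k generalizing x with
  | zero =>
    rw [maskProd_zero] at hx
    refine ⟨τ, fun i hi => by omega, fun i hi => by omega, ?_⟩
    rw [maskProd_zero]
    exact (hx.eq_of_length_le (by simp)).symm
  | succ k ih =>
    have ih := fun {x} => @ih (by omega) (fun i hi => hτ i (by omega)) x
    -- At a selected letter `s`, take `e = 1` and `x' = x s` if `s` is a right descent of `x`, and
    -- `e = 0` and `x' = x` otherwise. Lifting puts `x'` below the shorter product.
    have hstep : ∀ (x' : W) (e : Bool), cs.BruhatLE x' (cs.maskProd ω τ k) →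
        (e = true → τ ⟨k, hk⟩ = true) →
        (τ ⟨k, hk⟩ = true → cs.length x' < cs.length (x' * cs.simple (ω.get ⟨k, hk⟩))) →
        (x' * if e = true then cs.simple (ω.get ⟨k, hk⟩) else 1) = x →
        ∃ ν, cs.IsConstantMaskOn ω τ (k + 1) ν x := by
      intro x' e hx' he hnd hxx
      obtain ⟨ν, hν⟩ := ih hx'
      have hcongr : ∀ i : Fin ω.length, (i : ℕ) < k → ν i = Function.update ν ⟨k, hk⟩ e i := by
        intro i hi
        rw [Function.update_of_ne]
        rintro rfl
        exact lt_irrefl _ hi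
      have hν' := hν.congr (τ' := τ) (by omega) (fun _ _ => rfl) hcongr
      refine ⟨Function.update ν ⟨k, hk⟩ e, fun i hi => ?_, fun i hi hτi => ?_, ?_⟩
      · rcases Nat.lt_succ_iff_lt_or_eq.1 hi with hi | hi
        · exact hν'.1 i hi
        · obtain rfl : i = ⟨k, hk⟩ := Fin.ext hi
          simpa using he
      · rcases Nat.lt_succ_iff_lt_or_eq.1 hi with hi | hi
        · exact hν'.2.1 i hi hτi
        · obtain rfl : i = ⟨k, hk⟩ := Fin.ext hi
          rw [not_isDefect_iff, hν'.2.2]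
          exact hnd hτi
      · have h1 := maskProd_succ (cs := cs) (Function.update ν ⟨k, hk⟩ e) ⟨k, hk⟩
        simp only at h1
        rw [h1, hν'.2.2]
        simpa using hxx
    have h2 := maskProd_succ (cs := cs) τ ⟨k, hk⟩
    simp only at h2
    rw [h2] at hx
    cases hτk : τ ⟨k, hk⟩ with
    | false =>
      exact hstep x false (by simpa [hτk] using hx) (by simp) (by simp [hτk]) (by simp)
    | true =>
      have h4 := not_isDefect_iff.1 (hτ ⟨k, hk⟩ (Nat.lt_succ_self k) hτk)
      simp only [hτk, if_true] at hx
      rcases lt_or_gt_of_ne (cs.length_mul_simple_ne x (ω.get ⟨k, hk⟩)) with h5 | h5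
      · exact hstep (x * cs.simple (ω.get ⟨k, hk⟩)) true (hx.mul_simple_le h4 h5) (by simp [hτk])
          (fun _ => by simpa using h5) (by simp)
      · exact hstep x false (hx.of_le_mul_simple h4 h5) (by simp) (fun _ => h5) (by simp)

theorem isConstantMask_iff {m : Fin ω.length → Bool} {x : W} :
    cs.IsConstantMask ω m x ↔ cs.IsConstantMaskOn ω (fun _ => true) ω.length m x := by
  constructor
  · exact fun h => ⟨fun _ _ _ => rfl, fun i _ _ => h.1 i, h.2⟩
  · exact fun h => ⟨fun i => h.2.1 i i.2 rfl, h.2.2⟩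

end

end CoxeterSystem

/-! ### Relative masks encode the Bruhat interval -/

/-- The entry with given values of `notX` and `isOne`. -/
def MaskEntry.ofBools : Bool → Bool → MaskEntry
  | false, _ => .X
  | true, false => .zero
  | true, true => .one

theorem MaskEntry.ext_bools {e e' : MaskEntry} (h : e.notX = e'.notX) (h' : e.isOne = e'.isOne) :
    e = e' := by
  cases e <;> cases e' <;> simp_all [MaskEntry.notX, MaskEntry.isOne]

theorem MaskEntry.notX_of_isOne {e : MaskEntry} (h : e.isOne = true) : e.notX = true := by
  cases e <;> simp_all [MaskEntry.notX, MaskEntry.isOne]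

theorem MaskEntry.notX_ofBools (a b : Bool) : (ofBools a b).notX = a := by
  cases a <;> cases b <;> rfl

theorem MaskEntry.isOne_ofBools {a b : Bool} (h : b = true → a = true) :
    (ofBools a b).isOne = b := by
  cases a <;> cases b <;> simp_all [MaskEntry.ofBools, MaskEntry.isOne]

theorem MaskEntry.notX_eq_true_iff {e : MaskEntry} : e.notX = true ↔ e ≠ .X := by
  cases e <;> simp [MaskEntry.notX]

theorem MaskEntry.notX_eq_notX_iff {e e' : MaskEntry} : e.notX = e'.notX ↔ (e = .X ↔ e' = .X) := by
  cases e <;> cases e' <;> simp [MaskEntry.notX]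

namespace CoxeterSystem

variable {B W : Type*} [Group W] {M : CoxeterMatrix B} {cs : CoxeterSystem M W}

theorem bijOn_maskTop {ω : List B} (hω : cs.IsReduced ω) (y : W) :
    Set.BijOn (cs.maskTop ω) {σ | cs.IsRelativeMask ω y σ}
      (cs.bruhatInterval y (cs.wordProd ω)) := by
  refine ⟨fun σ hσ => ⟨?_, ?_⟩, fun σ hσ σ' hσ' h => ?_, fun x hx => ?_⟩
  · rw [← hσ.2.2.2]
    exact maskProd_le_maskProd le_rfl (fun i _ _ => hσ.1.1 i) hσ.2.1
  · rw [← maskProd_true_length]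
    exact maskProd_le_maskProd le_rfl (fun i _ _ => not_isDefect_true hω i) (fun _ _ _ => rfl)
  · have h1 := isConstantMask_iff.1 hσ.1
    have h2 := isConstantMask_iff.1 hσ'.1
    rw [← h] at h2
    have h3 : ∀ i, xMask σ i = xMask σ' i := fun i => h1.unique le_rfl h2 i i.2
    have h4 := hσ'.2.congr (τ' := xMask σ) (ν' := oneMask σ') le_rfl (fun i _ => (h3 i).symm)
      (fun _ _ => rfl)
    have h5 : ∀ i, oneMask σ i = oneMask σ' i := fun i => hσ.2.unique le_rfl h4 i i.2
    exact funext fun i => MaskEntry.ext_bools (h3 i) (h5 i)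
  · obtain ⟨τ, hτ⟩ := exists_isConstantMaskOn (cs := cs) (ω := ω) (τ := fun _ => true) le_rfl
      (fun i _ _ => not_isDefect_true hω i) (x := x) (by rw [maskProd_true_length]; exact hx.2)
    have hτ' := isConstantMask_iff.2 hτ
    obtain ⟨ν, hν⟩ := exists_isConstantMaskOn (cs := cs) (ω := ω) (τ := τ) le_rfl
      (fun i _ _ => hτ'.1 i) (x := y) (by rw [hτ'.2]; exact hx.1)
    have e1 : xMask (fun i => MaskEntry.ofBools (τ i) (ν i)) = τ :=
      funext fun i => MaskEntry.notX_ofBools _ _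
    have e2 : oneMask (fun i => MaskEntry.ofBools (τ i) (ν i)) = ν :=
      funext fun i => MaskEntry.isOne_ofBools (hν.1 i i.2)
    refine ⟨fun i => MaskEntry.ofBools (τ i) (ν i), ⟨?_, ?_⟩, ?_⟩
    · rw [maskTop, e1]
      exact ⟨hτ'.1, rfl⟩
    · rw [e1, e2]; exact hν
    · rw [maskTop, e1]; exact hτ'.2

end CoxeterSystem

/-! ### Non-comparability of products with a common right factor -/

namespace CoxeterSystem

variable {B W : Type*} [Group W] {M : CoxeterMatrix B} {cs : CoxeterSystem M W}

/-- Here `r u = u t` for the reflection `t = u⁻¹ r u`. Were it not `u s`, then `u s` would be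
shorter than `u t s = r u s`. -/
theorem simple_mul_eq_mul_simple {u : W} {i r : B}
    (h1 : cs.length u < cs.length (cs.simple r * u))
    (h2 : cs.length (cs.simple r * (u * cs.simple i)) < cs.length (u * cs.simple i)) :
    cs.simple r * u = u * cs.simple i := by
  by_contra hne
  have e : u * (u⁻¹ * cs.simple r * u) = cs.simple r * u := by group
  have := cs.length_mul_simple_lt_of_reflection (u := u) (t := u⁻¹ * cs.simple r * u)
    (by simpa using (cs.isReflection_simple r).conj u⁻¹) (by rwa [e]) i (by rwa [e])
  rw [e, mul_assoc] at this
  omega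

theorem length_simple_mul_mul {a g : W} {r : B} {m : ℕ} (hg : cs.length g ≤ m)
    (ha : cs.length (a * g) = cs.length a + m)
    (hr : cs.length (cs.simple r * a) < cs.length a) :
    cs.length (cs.simple r * a * g) = cs.length (cs.simple r * a) + m := by
  have h1 := cs.length_mul_le (cs.simple r * a) g
  have h2 := cs.length_simple_mul (a * g) r
  have h3 := cs.length_simple_mul a r
  rw [mul_assoc] at h1 ⊢
  omega

section

variable {Q : ℕ → W} {c : ℕ → B} {k : ℕ} (hQ0 : Q 0 = 1)
  (hQ : ∀ i ≤ k, Q (i + 1) = Q i * cs.simple (c i))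

include hQ0 hQ

theorem length_partialProd_le (i : ℕ) (hi : i ≤ k + 1) : cs.length (Q i) ≤ i := by
  induction i with
  | zero => simp [hQ0]
  | succ i ih =>
    rw [hQ i (by omega)]
    have := cs.length_mul_le (Q i) (cs.simple (c i))
    have := ih (by omega)
    have := cs.length_simple (c i)
    omega

theorem BruhatLE.mul_partialProd {u v : W} (h : cs.BruhatLE u v) {l : ℕ} (hl : l ≤ k + 1)
    (hv : ∀ i ≤ l, cs.length (v * Q i) = cs.length v + i) :
    cs.BruhatLE (u * Q l) (v * Q l) := by
  induction l with
  | zero => simpa [hQ0] using h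
  | succ l ih =>
    have h1 := hv l (by omega)
    have h2 := hv (l + 1) le_rfl
    rw [hQ l (by omega), ← mul_assoc] at h2
    rw [hQ l (by omega), ← mul_assoc, ← mul_assoc]
    exact (ih (by omega) fun i hi => hv i (by omega)).mul_simple (by omega)

/-- Induction on the length of `a`, cancelling a left descent `r` of `a`. For `a = 1` also `b = 1`,
and both sides have length `k + 1`, so comparability would be the equality excluded by `hne`. -/
theorem not_bruhatLE_simple_mul_partialProd {i : B}
    (hne : cs.simple i * Q k ≠ Q (k + 1)) {a b : W}
    (ha' : cs.length (a * (cs.simple i * Q k)) = cs.length a + (k + 1))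
    (ha : ∀ l ≤ k, cs.length (a * Q l) = cs.length a + l) (hba : cs.BruhatLE b a)
    (hb : ∀ l ≤ k + 1, cs.length (b * Q l) = cs.length b + l)
    (h : ∀ l ≤ k, ¬ cs.BruhatLE (b * Q (l + 1)) (a * Q l)) :
    ¬ cs.BruhatLE (b * Q (k + 1)) (a * (cs.simple i * Q k)) := by
  induction hn : cs.length a generalizing a b with
  | zero =>
    intro hle
    obtain rfl : a = 1 := by rwa [length_eq_zero_iff] at hn
    obtain rfl : b = 1 := hba.eq_of_length_le (by simp)
    have h1 := hle.eq_of_length_le (by rw [ha', hb _ le_rfl])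
    simp only [one_mul] at h1
    exact hne h1.symm
  | succ n ih =>
    intro hle
    obtain ⟨r, hr⟩ := cs.exists_leftDescent_of_ne_one (w := a) (by rintro rfl; simp at hn)
    rw [IsLeftDescent] at hr
    have hr1 := cs.length_simple_mul a r
    have hQl := length_partialProd_le hQ0 hQ
    have hlen : ∀ l ≤ k, cs.length (cs.simple r * a * Q l) = cs.length (cs.simple r * a) + l :=
      fun l hl => length_simple_mul_mul (hQl l (by omega)) (ha l hl) hr
    have hlen' : cs.length (cs.simple r * a * (cs.simple i * Q k)) =
        cs.length (cs.simple r * a) + (k + 1) := by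
      refine length_simple_mul_mul ?_ ha' hr
      have h1 := cs.length_mul_le (cs.simple i) (Q k)
      have h2 := hQl k (by omega)
      rw [cs.length_simple] at h1
      omega
    have hdesc : cs.length (cs.simple r * (a * (cs.simple i * Q k))) <
        cs.length (a * (cs.simple i * Q k)) := by
      rw [← mul_assoc, hlen', ha']; omega
    have hdescl : ∀ l ≤ k, cs.length (cs.simple r * (a * Q l)) < cs.length (a * Q l) := by
      intro l hl
      rw [← mul_assoc, hlen l hl, ha l hl]; omega
    -- If `r` is also a left descent of `b`, it is cancelled from both elements.
    rcases lt_or_gt_of_ne (cs.length_simple_mul_ne b r) with hrb | hrb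
    · have hlenb : ∀ l ≤ k + 1,
          cs.length (cs.simple r * b * Q l) = cs.length (cs.simple r * b) + l :=
        fun l hl => length_simple_mul_mul (hQl l hl) (hb l hl) hrb
      have hdescb : ∀ l ≤ k + 1, cs.length (cs.simple r * (b * Q l)) < cs.length (b * Q l) := by
        intro l hl
        rw [← mul_assoc, hlenb l hl, hb l hl]; omega
      refine ih hlen' hlen (hba.simple_mul_le_simple_mul hr hrb) hlenb ?_ (by omega) ?_
      · intro l hl hcon
        refine h l hl ?_
        have := hcon.simple_mul (i := r) (by simpa [mul_assoc] using hdescl l hl)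
        simpa [mul_assoc] using this
      · rw [mul_assoc, mul_assoc]
        exact hle.simple_mul_le_simple_mul hdesc (hdescb _ le_rfl)
    · have hbra := hba.simple_mul_le_of_lt hr hrb
      -- Now `b ≤ r a`. While `r` stays a left ascent of every `b Q_l`, it is cancelled from `a`
      -- alone.
      by_cases hx : ∀ l ≤ k + 1, cs.length (b * Q l) < cs.length (cs.simple r * (b * Q l))
      · refine ih hlen' hlen hbra hb ?_ (by omega) ?_
        · intro l hl hcon
          refine h l hl (hcon.trans ?_)
          have h1 := hdescl l hl
          have := bruhatLE_simple_mul (cs := cs) (u := cs.simple r * a * Q l) (i := r)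
            (by simpa [mul_assoc] using h1)
          simpa [mul_assoc] using this
        · rw [mul_assoc]
          exact hle.simple_mul_le_of_lt hdesc (hx _ le_rfl)
      -- Where `r` turns from ascent into descent, `b Q_{l+1} = r b Q_l`. As `b Q_l ≤ r a Q_l`, this
      -- lies below `a Q_l`, against `h`.
      · obtain ⟨l, hl, h1, h2⟩ : ∃ l ≤ k,
            cs.length (b * Q l) < cs.length (cs.simple r * (b * Q l)) ∧
            cs.length (cs.simple r * (b * Q (l + 1))) < cs.length (b * Q (l + 1)) := by
          by_contra hcon
          refine hx fun l => ?_
          induction l with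
          | zero => intro _; simpa [hQ0] using hrb
          | succ l ihl =>
            intro hl
            by_contra hnot
            refine hcon ⟨l, by omega, ihl (by omega), ?_⟩
            have := cs.length_simple_mul_ne (b * Q (l + 1)) r
            omega
        refine h l hl ?_
        rw [hQ l hl, ← mul_assoc b] at h2
        have h3 := simple_mul_eq_mul_simple h1 h2
        rw [hQ l hl, ← mul_assoc b, ← h3]
        have h4 := BruhatLE.mul_partialProd hQ0 hQ hbra (l := l) (by omega)
          (fun i hi => hlen i (by omega))
        have := h4.simple_mul (i := r) (by simpa [mul_assoc] using hdescl l hl)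
        simpa [mul_assoc] using this

end

end CoxeterSystem

/-! ### The rules at one position and their effect to its right -/

namespace CoxeterSystem

variable {B W : Type*} [Group W] {M : CoxeterMatrix B} {cs : CoxeterSystem M W}

/-- If `s` were a descent of `v`, lifting would give `u ≤ v s` and hence `u s ≤ v`. This turns
non-comparability into absence of a defect. -/
theorem BruhatLE.length_lt_of_not_le {u v : W} {i : B} (h : cs.BruhatLE u v)
    (hu : cs.length u < cs.length (u * cs.simple i)) (hn : ¬ cs.BruhatLE (u * cs.simple i) v) :
    cs.length v < cs.length (v * cs.simple i) := by
  rcases lt_or_gt_of_ne (cs.length_mul_simple_ne v i) with hv | hv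
  · refine absurd ?_ hn
    have h1 : cs.BruhatLE u (v * cs.simple i) :=
      BruhatLE.of_le_mul_simple (i := i) (by simpa using h) (by simpa using hv) hu
    simpa using h1.mul_simple (i := i) (by simpa using hv)
  · exact hv

section

variable {ω : List B}

theorem maskProd_tail {m : Fin ω.length → Bool} {j k : ℕ} (hjk : j ≤ k) (hk : k ≤ ω.length)
    (hm : ∀ r : Fin ω.length, j ≤ (r : ℕ) → m r = true) :
    cs.maskProd ω m k = cs.maskProd ω m j * ((cs.maskProd ω (fun _ => true) j)⁻¹ *
      cs.maskProd ω (fun _ => true) k) := by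
  induction k, hjk using Nat.le_induction with
  | base => simp
  | succ k hjk ih =>
    have h1 := maskProd_succ (cs := cs) m ⟨k, hk⟩
    have h2 := maskProd_succ (cs := cs) (fun _ => true) ⟨k, hk⟩
    simp only at h1 h2
    rw [h1, h2, ih (by omega), hm ⟨k, hk⟩ hjk]
    simp [mul_assoc]

theorem length_maskProd_tail {m : Fin ω.length → Bool} {j k : ℕ} (hjk : j ≤ k)
    (hk : k ≤ ω.length) (hm : ∀ r : Fin ω.length, j ≤ (r : ℕ) → m r = true)
    (hd : ∀ r : Fin ω.length, j ≤ (r : ℕ) → (r : ℕ) < k → ¬ cs.IsDefect ω m r) :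
    cs.length (cs.maskProd ω m k) + j = cs.length (cs.maskProd ω m j) + k := by
  induction k, hjk using Nat.le_induction with
  | base => rfl
  | succ k hjk ih =>
    have h1 := maskProd_succ (cs := cs) m ⟨k, hk⟩
    have h2 := not_isDefect_iff.1 (hd ⟨k, hk⟩ hjk (Nat.lt_succ_self k))
    have h3 := cs.length_mul_simple (cs.maskProd ω m k) (ω.get ⟨k, hk⟩)
    have h4 := ih (by omega) (fun r hr hr' => hd r hr (by omega))
    simp only [hm ⟨k, hk⟩ hjk, if_true] at h1 h2 h3
    rw [h1]
    omega

theorem isRelativeMask_iff {y : W} {σ : Fin ω.length → MaskEntry} :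
    cs.IsRelativeMask ω y σ ↔ (∀ i, ¬ cs.IsDefect ω (xMask σ) i) ∧
      (∀ i, σ i ≠ .X → ¬ cs.IsDefect ω (oneMask σ) i) ∧
      cs.maskProd ω (oneMask σ) ω.length = y := by
  constructor
  · exact fun h => ⟨h.1.1, fun _ hi => h.2.2.1 _ (Fin.isLt _) (MaskEntry.notX_eq_true_iff.2 hi), h.2.2.2⟩
  · exact fun h => ⟨⟨h.1, rfl⟩, fun _ _ => MaskEntry.notX_of_isOne,
      fun i _ hi => h.2.1 i (MaskEntry.notX_eq_true_iff.1 hi), h.2.2⟩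

/-- An `X` always meets (1) or (3), a `0` always meets (2). -/
theorem not_ruleApplies_iff {σ : Fin ω.length → MaskEntry} {k : Fin ω.length} :
    ¬ cs.RuleApplies ω σ k ↔ σ k = .one ∧ ¬ cs.IsShiftedDescent ω σ k := by
  unfold RuleApplies Cond1 Cond2 Cond3 Cond4
  by_cases hd : cs.IsDefect ω (oneMask σ) k <;> cases σ k <;> simp [hd]

theorem IsRelativeMask.oneProd_le {y : W} {σ : Fin ω.length → MaskEntry}
    (h : cs.IsRelativeMask ω y σ) {k : ℕ} (hk : k ≤ ω.length) :
    cs.BruhatLE (cs.maskProd ω (oneMask σ) k) (cs.maskProd ω (xMask σ) k) :=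
  maskProd_le_maskProd hk (fun i _ _ => h.1.1 i) (fun _ _ => MaskEntry.notX_of_isOne)

theorem oneProd_succ_of_ne {σ : Fin ω.length → MaskEntry} {j : Fin ω.length} (h : σ j ≠ .one) :
    cs.maskProd ω (oneMask σ) (j + 1) = cs.maskProd ω (oneMask σ) j := by
  rw [maskProd_succ, oneMask]
  cases hj : σ j <;> simp_all [MaskEntry.isOne]

theorem oneProd_succ_of_eq {σ : Fin ω.length → MaskEntry} {j : Fin ω.length} (h : σ j = .one) :
    cs.maskProd ω (oneMask σ) (j + 1) =
      cs.maskProd ω (oneMask σ) j * cs.simple (ω.get j) := by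
  rw [maskProd_succ, oneMask, h]
  simp [MaskEntry.isOne]

theorem xProd_succ_of_ne {σ : Fin ω.length → MaskEntry} {j : Fin ω.length} (h : σ j ≠ .X) :
    cs.maskProd ω (xMask σ) (j + 1) = cs.maskProd ω (xMask σ) j * cs.simple (ω.get j) := by
  rw [maskProd_succ, xMask]
  cases hj : σ j <;> simp_all [MaskEntry.notX]

theorem xProd_succ_of_eq {σ : Fin ω.length → MaskEntry} {j : Fin ω.length} (h : σ j = .X) :
    cs.maskProd ω (xMask σ) (j + 1) = cs.maskProd ω (xMask σ) j := by
  rw [maskProd_succ, xMask, h]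
  simp [MaskEntry.notX]

theorem IsRelativeMask.exists_reassignedAt {y : W} {σ : Fin ω.length → MaskEntry}
    (h : cs.IsRelativeMask ω y σ) (j : Fin ω.length) (e : MaskEntry) {u : W}
    (hu : cs.BruhatLE u (cs.maskProd ω (xMask σ) j)) :
    ∃ σ', cs.ReassignedAt ω σ σ' j e u := by
  obtain ⟨ν, hν⟩ := exists_isConstantMaskOn j.2.le (fun i _ _ => h.1.1 i) hu
  refine ⟨fun i => if i < j then MaskEntry.ofBools (xMask σ i) (ν i) else if i = j then e else σ i,
    fun i hi => ?_, hν.congr j.2.le (fun _ _ => rfl) (fun i hi => ?_), by simp, fun i hi => ?_⟩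
  · rw [← MaskEntry.notX_eq_notX_iff]; simp only [if_pos hi, MaskEntry.notX_ofBools]; rfl
  · rw [oneMask, if_pos (Fin.lt_def.2 hi), MaskEntry.isOne_ofBools (hν.1 i hi)]
  · simp [not_lt_of_gt hi, hi.ne']

theorem ReassignedAt.unique {σ σ' σ'' : Fin ω.length → MaskEntry} {j : Fin ω.length}
    {e : MaskEntry} {u : W} (h : cs.ReassignedAt ω σ σ' j e u)
    (h' : cs.ReassignedAt ω σ σ'' j e u) : σ' = σ'' := by
  funext i
  rcases lt_trichotomy i j with hi | rfl | hi
  · refine MaskEntry.ext_bools ?_ (h.2.1.unique j.2.le h'.2.1 i hi)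
    rw [MaskEntry.notX_eq_notX_iff, h.1 i hi, h'.1 i hi]
  · rw [h.2.2.1, h'.2.2.1]
  · rw [h.2.2.2 i hi, h'.2.2.2 i hi]

theorem RuleResult.unique {σ σ' σ'' : Fin ω.length → MaskEntry} {j : Fin ω.length}
    (h : cs.RuleResult ω σ σ' j) (h' : cs.RuleResult ω σ σ'' j) : σ' = σ'' := by
  unfold RuleResult Cond1 Cond2 Cond3 Cond4 at h h'
  by_cases hd : cs.IsDefect ω (oneMask σ) j <;> cases hj : σ j <;>
    simp only [hj, hd, reduceCtorEq, false_and, and_false, false_or, or_false, true_and, and_true,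
      not_true_eq_false, not_false_eq_true] at h h'
  · exact h.unique h'
  · rw [h, h']
  · exact h.2.unique h'.2
  · rw [h, h']
  · rw [h, h']
  · exact h.2.unique h'.2

theorem RuleResult.ruleApplies {σ σ' : Fin ω.length → MaskEntry} {j : Fin ω.length}
    (h : cs.RuleResult ω σ σ' j) : cs.RuleApplies ω σ j := by
  rcases h with h | h | h | h
  · exact Or.inl h.1
  · exact Or.inr (Or.inl h.1)
  · exact Or.inr (Or.inr (Or.inl h.1))
  · exact Or.inr (Or.inr (Or.inr h.1))

theorem IsRelativeMask.exists_ruleResult {y : W} {σ : Fin ω.length → MaskEntry}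
    (h : cs.IsRelativeMask ω y σ) {j : Fin ω.length} (hj : cs.RuleApplies ω σ j) :
    ∃ σ', cs.RuleResult ω σ σ' j := by
  rcases hj with hj | hj | hj | hj
  · exact ⟨_, Or.inl ⟨hj, rfl⟩⟩
  · exact ⟨_, Or.inr (Or.inl ⟨hj, rfl⟩)⟩
  -- The constant mask exists because `O_j s_j < O_j ≤ T_j`; for rule (4) the shifted descent is
  -- precisely what is needed.
  · obtain ⟨σ', hσ'⟩ := h.exists_reassignedAt j .one (hj.2.1.trans (h.oneProd_le j.2.le))
    exact ⟨σ', Or.inr (Or.inr (Or.inl ⟨hj, hσ'⟩))⟩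
  · obtain ⟨σ', hσ'⟩ := h.exists_reassignedAt j .X hj.2
    exact ⟨σ', Or.inr (Or.inr (Or.inr ⟨hj, hσ'⟩))⟩

/-- The relation between a vector and the result of a rule at position `j`, as far as it does not
depend on the rule. -/
structure LocalMove (cs : CoxeterSystem M W) (ω : List B) (σ σ' : Fin ω.length → MaskEntry)
    (j : Fin ω.length) : Prop where
  left : ∀ i < j, xMask σ' i = xMask σ i
  right : ∀ i, j < i → σ' i = σ i
  switch : σ' j = .X ↔ σ j ≠ .X
  oneProd : cs.maskProd ω (oneMask σ') (j + 1) = cs.maskProd ω (oneMask σ) (j + 1)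
  not_isDefect : ∀ i ≤ j, σ' i ≠ .X → ¬ cs.IsDefect ω (oneMask σ') i
  symm : cs.RuleResult ω σ' σ j

theorem oneMask_update_of_lt (σ : Fin ω.length → MaskEntry) {i j : Fin ω.length} (e : MaskEntry)
    (hi : i < j) : oneMask (Function.update σ j e) i = oneMask σ i := by
  simp [oneMask, hi.ne]

theorem IsRelativeMask.localMove_update {y : W} {σ : Fin ω.length → MaskEntry}
    (h : cs.IsRelativeMask ω y σ) {j : Fin ω.length} {e : MaskEntry} (he : e = .X ↔ σ j ≠ .X)
    (he1 : e ≠ .one) (hj : σ j ≠ .one) (hd : ¬ cs.IsDefect ω (oneMask σ) j)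
    (hr : cs.RuleResult ω (Function.update σ j e) σ j) :
    cs.LocalMove ω σ (Function.update σ j e) j where
  left i hi := by simp [xMask, hi.ne]
  right i hi := by simp [hi.ne']
  switch := by simpa using he
  oneProd := by
    rw [oneProd_succ_of_ne (by simpa using he1), oneProd_succ_of_ne hj]
    exact maskProd_congr j.2.le fun i hi => oneMask_update_of_lt σ e hi
  not_isDefect i hi hne := by
    rw [isDefect_congr fun l hl => oneMask_update_of_lt σ e (hl.trans_le hi)]
    rcases hi.lt_or_eq with hi | rfl
    · exact (isRelativeMask_iff.1 h).2.1 i (by simpa [hi.ne] using hne)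
    · exact hd
  symm := hr

theorem IsRelativeMask.reassignedAt_symm {y : W} {σ σ' : Fin ω.length → MaskEntry}
    (h : cs.IsRelativeMask ω y σ) {j : Fin ω.length} {e : MaskEntry} {u : W}
    (hr : cs.ReassignedAt ω σ σ' j e u) :
    cs.ReassignedAt ω σ' σ j (σ j) (cs.maskProd ω (oneMask σ) j) :=
  ⟨fun i hi => (hr.1 i hi).symm,
    (h.2.prefix j.2.le).congr j.2.le
      (fun i hi => (MaskEntry.notX_eq_notX_iff.2 (hr.1 i hi)).symm) (fun _ _ => rfl),
    rfl, fun i hi => (hr.2.2.2 i hi).symm⟩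

/-- Each rule keeps `O_{j+1}` and creates the condition of its partner. For instance, after (3)
position `j` is a shifted descent since `O'_{j+1} = O_j ≤ T_j`. -/
theorem RuleResult.localMove {y : W} {σ σ' : Fin ω.length → MaskEntry} {j : Fin ω.length}
    (hr : cs.RuleResult ω σ σ' j) (h : cs.IsRelativeMask ω y σ) : cs.LocalMove ω σ σ' j := by
  have hcongr : ∀ e, cs.IsDefect ω (oneMask (Function.update σ j e)) j ↔
      cs.IsDefect ω (oneMask σ) j := fun e =>
    isDefect_congr fun l hl => oneMask_update_of_lt σ e hl
  rcases hr with ⟨hc, rfl⟩ | ⟨hc, rfl⟩ | ⟨hc, hr⟩ | ⟨hc, hr⟩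
  · refine h.localMove_update (by simp [hc.1]) (by simp) (by simp [hc.1]) hc.2 ?_
    refine Or.inr (Or.inl ⟨by simp [Cond2], ?_⟩)
    rw [Function.update_idem, ← hc.1, Function.update_eq_self]
  · have hj : σ j = .zero := hc
    have hd := (isRelativeMask_iff.1 h).2.1 j (by simp [hj])
    refine h.localMove_update (by simp [hj]) (by simp) (by simp [hj]) hd ?_
    refine Or.inl ⟨⟨by simp, by rwa [hcongr]⟩, ?_⟩
    rw [Function.update_idem, ← hj, Function.update_eq_self]
  · have hO' := oneProd_succ_of_eq (cs := cs) hr.2.2.1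
    have hO := oneProd_succ_of_ne (cs := cs) (σ := σ) (j := j) (by simp [hc.1])
    rw [hr.2.1.2.2] at hO'
    have hOO : cs.maskProd ω (oneMask σ') (j + 1) = cs.maskProd ω (oneMask σ) j := by
      rw [hO']; simp
    have hs := h.reassignedAt_symm hr
    have hxx : cs.maskProd ω (xMask σ') j = cs.maskProd ω (xMask σ) j :=
      maskProd_congr j.2.le fun i hi => MaskEntry.notX_eq_notX_iff.2 (hr.1 i hi)
    refine ⟨fun i hi => MaskEntry.notX_eq_notX_iff.2 (hr.1 i hi), hr.2.2.2,
      by simp [hr.2.2.1, hc.1], hOO.trans hO.symm, fun i hi hne => ?_, ?_⟩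
    · rcases hi.lt_or_eq with hi | rfl
      · refine hr.2.1.2.1 i hi (MaskEntry.notX_eq_true_iff.2 fun hX => hne ((hr.1 i hi).2 hX))
      · rw [not_isDefect_iff, hr.2.1.2.2]
        simpa using isDefect_iff.1 hc.2
    · refine Or.inr (Or.inr (Or.inr ⟨⟨hr.2.2.1, ?_⟩, ?_⟩))
      · rw [IsShiftedDescent, hOO, hxx]
        exact h.oneProd_le j.2.le
      · rw [hOO, ← hc.1]; exact hs
  · have hO' := oneProd_succ_of_ne (cs := cs) (σ := σ') (j := j) (by simp [hr.2.2.1])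
    have hO := oneProd_succ_of_eq (cs := cs) hc.1
    rw [hr.2.1.2.2] at hO'
    have hs := h.reassignedAt_symm hr
    refine ⟨fun i hi => MaskEntry.notX_eq_notX_iff.2 (hr.1 i hi), hr.2.2.2,
      by simp [hr.2.2.1, hc.1], hO', fun i hi hne => ?_, ?_⟩
    · rcases hi.lt_or_eq with hi | rfl
      · refine hr.2.1.2.1 i hi (MaskEntry.notX_eq_true_iff.2 fun hX => hne ((hr.1 i hi).2 hX))
      · exact absurd hr.2.2.1 hne
    · refine Or.inr (Or.inr (Or.inl ⟨⟨hr.2.2.1, ?_⟩, ?_⟩))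
      · rw [isDefect_iff, hr.2.1.2.2, hO]
        simpa using not_isDefect_iff.1 ((isRelativeMask_iff.1 h).2.1 j (by simp [hc.1]))
      · rw [hr.2.1.2.2, hO, simple_mul_simple_cancel_right, ← hc.1]; exact hs

theorem LocalMove.oneProd_eq {σ σ' : Fin ω.length → MaskEntry} {j : Fin ω.length}
    (h : cs.LocalMove ω σ σ' j) {k : ℕ} (hjk : (j : ℕ) + 1 ≤ k) (hk : k ≤ ω.length) :
    cs.maskProd ω (oneMask σ') k = cs.maskProd ω (oneMask σ) k := by
  induction k, hjk using Nat.le_induction with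
  | base => exact h.oneProd
  | succ k hjk ih =>
    have h1 := maskProd_succ (cs := cs) (oneMask σ') ⟨k, hk⟩
    have h2 := maskProd_succ (cs := cs) (oneMask σ) ⟨k, hk⟩
    simp only at h1 h2
    rw [h1, h2, ih (by omega), oneMask, oneMask, h.right ⟨k, hk⟩ (Fin.lt_def.2 (by simpa using hjk))]

theorem LocalMove.xProd_eq {σ σ' : Fin ω.length → MaskEntry} {j : Fin ω.length}
    (h : cs.LocalMove ω σ σ' j) :
    cs.maskProd ω (xMask σ') j = cs.maskProd ω (xMask σ) j :=
  maskProd_congr j.2.le h.left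

theorem LocalMove.xProd_le {y : W} {σ σ' : Fin ω.length → MaskEntry} {j : Fin ω.length}
    (h : cs.LocalMove ω σ σ' j) (hσ : cs.IsRelativeMask ω y σ) (hj : σ' j = .X) {k : ℕ}
    (hk : k ≤ ω.length) :
    cs.BruhatLE (cs.maskProd ω (xMask σ') k) (cs.maskProd ω (xMask σ) k) := by
  refine maskProd_le_maskProd hk (fun i _ _ => hσ.1.1 i) fun i _ hi => ?_
  rcases lt_trichotomy i j with hij | rfl | hij
  · rwa [← h.left i hij]
  · exact absurd hj (MaskEntry.notX_eq_true_iff.1 hi)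
  · rw [xMask, ← h.right i hij]; exact hi

/-- The case where an `X` is removed, with `a = T_{j+1} = T_j`, `b = O_{j+1}` and `Q l` the product
of the `l` letters after `j`. The hypotheses on shifted descents right of `j` become `b Q_{l+1} ≰ a
Q_l`. -/
theorem LocalMove.not_bruhatLE_of_increasing (hω : cs.IsReduced ω) {y : W}
    {σ σ' : Fin ω.length → MaskEntry} {j : Fin ω.length} (h : cs.LocalMove ω σ σ' j)
    (hσ : cs.IsRelativeMask ω y σ) (hlast : ∀ k, j < k → ¬ cs.RuleApplies ω σ k)
    (hj : σ j = .X) {i : Fin ω.length} (hji : j < i)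
    (hd : ∀ l < i, ¬ cs.IsDefect ω (xMask σ') l) :
    ¬ cs.BruhatLE (cs.maskProd ω (oneMask σ) (i + 1)) (cs.maskProd ω (xMask σ') i) := by
  have hj' : σ' j ≠ .X := fun h' => h.switch.1 h' hj
  have hone : ∀ r : Fin ω.length, (j : ℕ) + 1 ≤ r → σ r = .one := fun r hr =>
    (not_ruleApplies_iff.1 (hlast r hr)).1
  have hone' : ∀ r : Fin ω.length, (j : ℕ) + 1 ≤ r → σ' r = .one := fun r hr => by
    rw [h.right r hr, hone r hr]
  have hmo : ∀ r : Fin ω.length, (j : ℕ) + 1 ≤ r → oneMask σ r = true := fun r hr => by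
    simp [oneMask, hone r hr, MaskEntry.isOne]
  have hmx : ∀ r : Fin ω.length, (j : ℕ) + 1 ≤ r → xMask σ r = true := fun r hr => by
    simp [xMask, hone r hr, MaskEntry.notX]
  have hmx' : ∀ r : Fin ω.length, (j : ℕ) + 1 ≤ r → xMask σ' r = true := fun r hr => by
    simp [xMask, hone' r hr, MaskEntry.notX]
  have hO : ∀ r : Fin ω.length, (j : ℕ) + 1 ≤ r → ¬ cs.IsDefect ω (oneMask σ) r := fun r hr =>
    (isRelativeMask_iff.1 hσ).2.1 r (by simp [hone r hr])
  obtain ⟨k, hk⟩ := Nat.exists_eq_add_of_le (show (j : ℕ) + 1 ≤ i from hji)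
  have hi := i.2
  set F := fun l => cs.maskProd ω (fun _ => true) l with hF
  set Q := fun l => (F (j + 1))⁻¹ * F (j + 1 + l) with hQdef
  have hQ0 : Q 0 = 1 := by simp [hQdef]
  -- The default value `ω.get j` only makes the sequence of letters total; it is not reached for `l
  -- ≤ k`.
  have hQ : ∀ l ≤ k, Q (l + 1) = Q l * cs.simple ((fun l => ω.getD (j + 1 + l) (ω.get j)) l) := by
    intro l hl
    have h1 := maskProd_succ (cs := cs) (ω := ω) (fun _ => true) ⟨j + 1 + l, by omega⟩
    simp only [if_true] at h1
    simp only [hQdef, hF]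
    rw [← add_assoc, h1, List.getD_eq_getElem ω _ (show j + 1 + l < ω.length by omega), mul_assoc]
    rfl
  have hT : ∀ l ≤ k + 1, cs.maskProd ω (xMask σ) (j + 1 + l) =
      cs.maskProd ω (xMask σ) (j + 1) * Q l := fun l hl =>
    maskProd_tail (by omega) (by omega) hmx
  have hOt : ∀ l ≤ k + 1, cs.maskProd ω (oneMask σ) (j + 1 + l) =
      cs.maskProd ω (oneMask σ) (j + 1) * Q l := fun l hl =>
    maskProd_tail (by omega) (by omega) hmo
  have hT' : cs.maskProd ω (xMask σ') i =
      cs.maskProd ω (xMask σ) (j + 1) * (cs.simple (ω.get j) * Q k) := by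
    rw [hk, maskProd_tail (by omega) (by omega) hmx', xProd_succ_of_ne hj', h.xProd_eq,
      xProd_succ_of_eq hj, mul_assoc]
  rw [hT', hk, add_assoc, hOt (k + 1) le_rfl]
  refine not_bruhatLE_simple_mul_partialProd hQ0 hQ ?_ ?_ ?_ (hσ.oneProd_le j.2) ?_ ?_
  -- Equality would cancel the letter `s_j`, giving the reduced prefix of length `i + 1 = j + k + 2`
  -- a length of at most `j + k`.
  · intro hcon
    have h1 : F (j + 1) = F j * cs.simple (ω.get j) := by
      simpa using maskProd_succ (cs := cs) (fun _ => true) j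
    have h2 : F (i + 1) = F j * Q k := by
      have h3 : F (i + 1) = F (j + 1) * Q (k + 1) := by
        rw [hk]; simp [hQdef, add_assoc]
      rw [h3, ← hcon, h1]
      simp [mul_assoc]
    have h4 := cs.length_mul_le (F j) (Q k)
    rw [← h2, hF] at h4
    simp only at h4
    rw [length_maskProd_true hω hi, length_maskProd_true hω j.2.le] at h4
    have := length_partialProd_le hQ0 hQ k (by omega)
    omega
  -- Additivity for `a s_j Q_k` is the absence of defects of the new `X`-mask before `i`.
  · have h1 := length_maskProd_tail (cs := cs) (m := xMask σ') (j := j + 1) (k := i) hji hi.le hmx'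
      (fun r _ hr => hd r hr)
    have h2 := not_isDefect_iff.1 (hd j hji)
    have h3 := cs.length_mul_simple (cs.maskProd ω (xMask σ') j) (ω.get j)
    rw [hT', xProd_succ_of_ne hj'] at h1
    rw [xProd_succ_of_eq hj, ← h.xProd_eq] at h1 ⊢
    omega
  · intro l hl
    rw [← hT l (by omega)]
    have := length_maskProd_tail (cs := cs) (j := j + 1) (k := j + 1 + l) (by omega) (by omega) hmx
      (fun r _ _ => hσ.1.1 r)
    omega
  · intro l hl
    rw [← hOt l (by omega)]
    have := length_maskProd_tail (cs := cs) (j := j + 1) (k := j + 1 + l) (by omega) (by omega) hmo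
      (fun r hr _ => hO r hr)
    omega
  · intro l hl
    rw [← hT l (by omega), ← hOt (l + 1) (by omega)]
    exact (not_ruleApplies_iff.1 (hlast ⟨j + 1 + l, by omega⟩ (Fin.lt_def.2 (by simp; omega)))).2

theorem LocalMove.not_bruhatLE (hω : cs.IsReduced ω) {y : W}
    {σ σ' : Fin ω.length → MaskEntry} {j : Fin ω.length} (h : cs.LocalMove ω σ σ' j)
    (hσ : cs.IsRelativeMask ω y σ) (hlast : ∀ k, j < k → ¬ cs.RuleApplies ω σ k)
    {i : Fin ω.length} (hji : j < i) (hd : ∀ l < i, ¬ cs.IsDefect ω (xMask σ') l) :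
    ¬ cs.BruhatLE (cs.maskProd ω (oneMask σ) (i + 1)) (cs.maskProd ω (xMask σ') i) := by
  by_cases hj : σ j = .X
  · exact h.not_bruhatLE_of_increasing hω hσ hlast hj hji hd
  · intro hle
    exact (not_ruleApplies_iff.1 (hlast i hji)).2
      (hle.trans (h.xProd_le hσ (h.switch.2 hj) i.2.le))

/-- Strong induction on the position: non-comparability at `i` presupposes that the new `X`-mask has
no defect before `i`, and excludes one at `i`. -/
theorem LocalMove.not_isDefect_xMask (hω : cs.IsReduced ω) {y : W}
    {σ σ' : Fin ω.length → MaskEntry} {j : Fin ω.length} (h : cs.LocalMove ω σ σ' j)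
    (hσ : cs.IsRelativeMask ω y σ) (hlast : ∀ k, j < k → ¬ cs.RuleApplies ω σ k)
    (i : Fin ω.length) : ¬ cs.IsDefect ω (xMask σ') i := by
  induction i using WellFoundedLT.induction with
  | ind i ih =>
    rcases le_or_gt i j with hij | hji
    · rw [isDefect_congr fun l hl => h.left l (hl.trans_le hij)]
      exact hσ.1.1 i
    · have hone := (not_ruleApplies_iff.1 (hlast i hji)).1
      have h1 := h.not_bruhatLE hω hσ hlast hji ih
      have h2 : cs.BruhatLE (cs.maskProd ω (oneMask σ) i) (cs.maskProd ω (xMask σ') i) := by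
        rw [← h.oneProd_eq hji i.2.le]
        exact maskProd_le_maskProd i.2.le (fun l hl _ => ih l hl)
          (fun l _ => MaskEntry.notX_of_isOne)
      rw [oneProd_succ_of_eq hone] at h1
      rw [not_isDefect_iff]
      exact h2.length_lt_of_not_le
        (not_isDefect_iff.1 ((isRelativeMask_iff.1 hσ).2.1 i (by simp [hone]))) h1

theorem LocalMove.isRelativeMask (hω : cs.IsReduced ω) {y : W}
    {σ σ' : Fin ω.length → MaskEntry} {j : Fin ω.length} (h : cs.LocalMove ω σ σ' j)
    (hσ : cs.IsRelativeMask ω y σ) (hlast : ∀ k, j < k → ¬ cs.RuleApplies ω σ k) :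
    cs.IsRelativeMask ω y σ' := by
  refine isRelativeMask_iff.2 ⟨h.not_isDefect_xMask hω hσ hlast, fun i hi => ?_, ?_⟩
  · rcases le_or_gt i j with hij | hji
    · exact h.not_isDefect i hij hi
    · rw [isDefect_iff, h.oneProd_eq hji i.2.le, ← isDefect_iff]
      exact (isRelativeMask_iff.1 hσ).2.1 i (by rwa [← h.right i hji])
  · rw [h.oneProd_eq j.2 le_rfl]
    exact hσ.2.2.2

/-! ### The rightmost move: involution and coverings -/

theorem IsMatchingMove.exists_localMove {y : W} {σ σ' : Fin ω.length → MaskEntry}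
    (h : cs.IsMatchingMove ω σ σ') (hσ : cs.IsRelativeMask ω y σ) :
    ∃ j, cs.LocalMove ω σ σ' j ∧ ∀ k, j < k → ¬ cs.RuleApplies ω σ k := by
  obtain ⟨j, -, h1, h2⟩ := h
  exact ⟨j, h2.localMove hσ, h1⟩

theorem IsMatchingMove.isRelativeMask (hω : cs.IsReduced ω) {y : W}
    {σ σ' : Fin ω.length → MaskEntry} (h : cs.IsMatchingMove ω σ σ')
    (hσ : cs.IsRelativeMask ω y σ) : cs.IsRelativeMask ω y σ' := by
  obtain ⟨j, hm, hlast⟩ := h.exists_localMove hσ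
  exact hm.isRelativeMask hω hσ hlast

/-- Position `j` is again rightmost: the entries after it are still `1`, and non-comparability says
that none of them is a shifted descent for the new mask. -/
theorem IsMatchingMove.symm (hω : cs.IsReduced ω) {y : W}
    {σ σ' : Fin ω.length → MaskEntry} (h : cs.IsMatchingMove ω σ σ')
    (hσ : cs.IsRelativeMask ω y σ) : cs.IsMatchingMove ω σ' σ := by
  obtain ⟨j, hm, hlast⟩ := h.exists_localMove hσ
  refine ⟨j, hm.symm.ruleApplies, fun k hk => not_ruleApplies_iff.2 ⟨?_, ?_⟩, hm.symm⟩
  · rw [hm.right k hk, (not_ruleApplies_iff.1 (hlast k hk)).1]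
  · rw [IsShiftedDescent, hm.oneProd_eq (by have := Fin.lt_def.1 hk; omega) k.2]
    exact hm.not_bruhatLE hω hσ hlast hk fun l _ => hm.not_isDefect_xMask hω hσ hlast l

theorem IsMatchingMove.unique {σ σ' σ'' : Fin ω.length → MaskEntry}
    (h : cs.IsMatchingMove ω σ σ') (h' : cs.IsMatchingMove ω σ σ'') : σ' = σ'' := by
  obtain ⟨j, h1, h2, h3⟩ := h
  obtain ⟨j', h1', h2', h3'⟩ := h'
  obtain rfl : j = j' := by
    rcases lt_trichotomy j j' with hlt | rfl | hlt
    · exact absurd h1' (h2 _ hlt)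
    · rfl
    · exact absurd h1 (h2' _ hlt)
  exact h3.unique h3'

theorem IsRelativeMask.exists_isMatchingMove {y : W} {σ : Fin ω.length → MaskEntry}
    (hσ : cs.IsRelativeMask ω y σ) (h : ∃ j, cs.RuleApplies ω σ j) :
    ∃ σ', cs.IsMatchingMove ω σ σ' := by
  classical
  obtain ⟨j, hj, hmax⟩ := (Set.toFinite {j | cs.RuleApplies ω σ j}).exists_maximal h
  obtain ⟨σ', h'⟩ := hσ.exists_ruleResult hj
  exact ⟨σ', j, hj, fun k hk hk' => absurd (hmax hk' hk.le) (not_le_of_gt hk), h'⟩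

theorem IsMatchingMove.matchingMap_eq {σ σ' : Fin ω.length → MaskEntry}
    (h : cs.IsMatchingMove ω σ σ') : cs.matchingMap ω σ = σ' := by
  have h' : ∃ σ', cs.IsMatchingMove ω σ σ' := ⟨σ', h⟩
  rw [matchingMap, dif_pos h']
  exact h'.choose_spec.unique h

theorem matchingMap_of_not_exists {σ : Fin ω.length → MaskEntry}
    (h : ¬ ∃ σ', cs.IsMatchingMove ω σ σ') : cs.matchingMap ω σ = σ := by
  rw [matchingMap, dif_neg h]

theorem IsMatchingMove.existsUnique_switch {y : W} {σ σ' : Fin ω.length → MaskEntry}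
    (h : cs.IsMatchingMove ω σ σ') (hσ : cs.IsRelativeMask ω y σ) :
    ∃! j, ¬ (σ' j = .X ↔ σ j = .X) := by
  obtain ⟨j, hm, -⟩ := h.exists_localMove hσ
  refine ⟨j, by simp only [hm.switch]; tauto, fun i hi => ?_⟩
  rcases lt_trichotomy i j with hij | rfl | hij
  · exact absurd (MaskEntry.notX_eq_notX_iff.1 (hm.left i hij)) hi
  · rfl
  · exact absurd (by rw [hm.right i hij]) hi

/-- After `j` both `X`-masks select every letter without defects, so the difference of lengths is
the one created at `j`. -/
theorem IsMatchingMove.maskTop_le_and_length (hω : cs.IsReduced ω) {y : W}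
    {σ σ' : Fin ω.length → MaskEntry} (h : cs.IsMatchingMove ω σ σ')
    (hσ : cs.IsRelativeMask ω y σ) :
    (cs.BruhatLE (cs.maskTop ω σ') (cs.maskTop ω σ) ∧
      cs.length (cs.maskTop ω σ) = cs.length (cs.maskTop ω σ') + 1) ∨
    (cs.BruhatLE (cs.maskTop ω σ) (cs.maskTop ω σ') ∧
      cs.length (cs.maskTop ω σ') = cs.length (cs.maskTop ω σ) + 1) := by
  have key : ∀ {σ σ' : Fin ω.length → MaskEntry} {j : Fin ω.length}, cs.LocalMove ω σ σ' j →
      cs.IsRelativeMask ω y σ → (∀ k, j < k → ¬ cs.RuleApplies ω σ k) → σ' j = .X →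
      cs.BruhatLE (cs.maskTop ω σ') (cs.maskTop ω σ) ∧
      cs.length (cs.maskTop ω σ) = cs.length (cs.maskTop ω σ') + 1 := by
    intro σ σ' j hm hσ hlast hj
    refine ⟨hm.xProd_le hσ hj le_rfl, ?_⟩
    have hx : ∀ r : Fin ω.length, (j : ℕ) + 1 ≤ r → xMask σ r = true := fun r hr => by
      simp [xMask, (not_ruleApplies_iff.1 (hlast r hr)).1, MaskEntry.notX]
    have h1 := length_maskProd_tail (cs := cs) j.2 le_rfl hx (fun r _ _ => hσ.1.1 r)
    have h2 := length_maskProd_tail (cs := cs) (m := xMask σ') j.2 le_rfl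
      (fun r hr => by rw [← hx r hr, xMask, xMask, hm.right r hr])
      (fun r _ _ => hm.not_isDefect_xMask hω hσ hlast r)
    have h3 := not_isDefect_iff.1 (hσ.1.1 j)
    have h4 := cs.length_mul_simple (cs.maskProd ω (xMask σ) j) (ω.get j)
    rw [Nat.succ_eq_add_one, xProd_succ_of_ne (hm.switch.1 hj)] at h1
    rw [Nat.succ_eq_add_one, xProd_succ_of_eq hj, hm.xProd_eq] at h2
    simp only [maskTop]
    omega
  obtain ⟨j, hm, hlast⟩ := h.exists_localMove hσ
  by_cases hj : σ' j = .X
  · exact Or.inl (key hm hσ hlast hj)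
  · refine Or.inr ?_
    -- If `j` stops being `X`, the reverse move is of the kind treated in `key`; it acts at the same
    -- position since only one entry switches.
    obtain ⟨j', hm', hlast'⟩ := (h.symm hω hσ).exists_localMove (h.isRelativeMask hω hσ)
    have hjj : j' = j := by
      obtain ⟨l, -, hl⟩ := h.existsUnique_switch hσ
      rw [hl j (by simp only [hm.switch]; tauto), hl j' (by simp only [hm'.switch]; tauto)]
    subst hjj
    exact key hm' (h.isRelativeMask hω hσ) hlast' (hm'.switch.2 hj)

theorem IsRelativeMask.exists_ruleApplies {y : W} {σ : Fin ω.length → MaskEntry}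
    (hσ : cs.IsRelativeMask ω y σ) (hy : y ≠ cs.wordProd ω) : ∃ j, cs.RuleApplies ω σ j := by
  by_contra hn
  refine hy ?_
  rw [← hσ.2.2.2, ← maskProd_true_length]
  refine maskProd_congr le_rfl fun i _ => ?_
  have := (not_ruleApplies_iff.1 fun hi => hn ⟨i, hi⟩).1
  simp [oneMask, this, MaskEntry.isOne]

theorem IsRelativeMask.matchingMap (hω : cs.IsReduced ω) {y : W} {σ : Fin ω.length → MaskEntry}
    (hσ : cs.IsRelativeMask ω y σ) : cs.IsRelativeMask ω y (cs.matchingMap ω σ) := by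
  by_cases h : ∃ σ', cs.IsMatchingMove ω σ σ'
  · obtain ⟨σ', h⟩ := h
    rw [h.matchingMap_eq]
    exact h.isRelativeMask hω hσ
  · rwa [matchingMap_of_not_exists h]

theorem IsRelativeMask.matchingMap_matchingMap (hω : cs.IsReduced ω) {y : W}
    {σ : Fin ω.length → MaskEntry} (hσ : cs.IsRelativeMask ω y σ) :
    cs.matchingMap ω (cs.matchingMap ω σ) = σ := by
  by_cases h : ∃ σ', cs.IsMatchingMove ω σ σ'
  · obtain ⟨σ', h⟩ := h
    rw [h.matchingMap_eq]
    exact (h.symm hω hσ).matchingMap_eq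
  · rw [matchingMap_of_not_exists h, matchingMap_of_not_exists h]

theorem bruhatCovers_of_length {y w : W} {a b : cs.bruhatInterval y w} (h : cs.BruhatLE a b)
    (hl : cs.length (b : W) = cs.length (a : W) + 1) : cs.BruhatCovers y w a b := by
  refine ⟨⟨h, fun e => by rw [e] at hl; omega⟩, ?_⟩
  rintro ⟨c, h1, h2⟩
  have := h1.length_lt
  have := h2.length_lt
  omega

end

end CoxeterSystem

theorem theoremt {B W : Type*} [Group W] {M : CoxeterMatrix B} (cs : CoxeterSystem M W)
    (ω : List B) (hω : cs.IsReduced ω) (y : W) (hy : cs.BruhatLE y (cs.wordProd ω)) :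
    -- relative masks for `y` encode the interval `[y, w]`
    Set.BijOn (cs.maskTop ω) {σ | cs.IsRelativeMask ω y σ}
      (cs.bruhatInterval y (cs.wordProd ω)) ∧
    -- wherever a rule applies, the move at the rightmost applicable position is well defined
    (∀ σ, cs.IsRelativeMask ω y σ → (∃ j, cs.RuleApplies ω σ j) →
      ∃! σ', cs.IsMatchingMove ω σ σ') ∧
    -- `φ` is an involution of the set of relative masks for `y`
    (∀ σ, cs.IsRelativeMask ω y σ → cs.IsRelativeMask ω y (cs.matchingMap ω σ) ∧
      cs.matchingMap ω (cs.matchingMap ω σ) = σ) ∧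
    -- if `y < w`, then some rule always applies, exactly one `X` entry is interchanged with a
    -- `0` or `1` entry, and `φ` induces a complete matching of the Hasse diagram of `[y, w]`
    (cs.BruhatLT y (cs.wordProd ω) →
      (∀ σ, cs.IsRelativeMask ω y σ →
        cs.IsMatchingMove ω σ (cs.matchingMap ω σ) ∧
        ∃! j, ¬ (cs.matchingMap ω σ j = MaskEntry.X ↔ σ j = MaskEntry.X)) ∧
      ∃ G : (cs.bruhatHasse y (cs.wordProd ω)).Subgraph,
        (∀ a b, G.Adj a b ↔ ∃ σ, cs.IsRelativeMask ω y σ ∧ cs.maskTop ω σ = a ∧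
          cs.maskTop ω (cs.matchingMap ω σ) = b) ∧
        G.IsPerfectMatching) := by
  have hbij := CoxeterSystem.bijOn_maskTop hω y
  refine ⟨hbij, fun σ hσ hex => ?_, fun σ hσ =>
    ⟨hσ.matchingMap hω, hσ.matchingMap_matchingMap hω⟩, fun hlt => ?_⟩
  · obtain ⟨σ', h⟩ := hσ.exists_isMatchingMove hex
    exact ⟨σ', h, fun σ'' h'' => h''.unique h⟩
  · have hmove : ∀ σ, cs.IsRelativeMask ω y σ →
        cs.IsMatchingMove ω σ (cs.matchingMap ω σ) := by
      intro σ hσ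
      obtain ⟨σ', h⟩ := hσ.exists_isMatchingMove (hσ.exists_ruleApplies hlt.2)
      rwa [h.matchingMap_eq]
    refine ⟨fun σ hσ => ⟨hmove σ hσ, (hmove σ hσ).existsUnique_switch hσ⟩,
      { verts := Set.univ
        Adj := fun a b => ∃ σ, cs.IsRelativeMask ω y σ ∧ cs.maskTop ω σ = a ∧
          cs.maskTop ω (cs.matchingMap ω σ) = b
        adj_sub := ?_
        edge_vert := fun _ => Set.mem_univ _
        symm := ?_ }, fun a b => Iff.rfl, ?_, fun _ => Set.mem_univ _⟩
    · rintro a b ⟨σ, hσ, ha, hb⟩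
      rcases (hmove σ hσ).maskTop_le_and_length hω hσ with ⟨h1, h2⟩ | ⟨h1, h2⟩
      · rw [ha, hb] at h1 h2
        exact Or.inr (CoxeterSystem.bruhatCovers_of_length h1 h2)
      · rw [ha, hb] at h1 h2
        exact Or.inl (CoxeterSystem.bruhatCovers_of_length h1 h2)
    · refine ⟨?_⟩
      rintro a b ⟨σ, hσ, ha, hb⟩
      exact ⟨_, hσ.matchingMap hω, hb, by rw [hσ.matchingMap_matchingMap hω, ha]⟩
    · intro a _
      -- The partner of `a` comes from its encoding mask; injectivity of the encoding makes it the
      -- only one.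
      obtain ⟨σ, hσ, ha⟩ := hbij.surjOn a.2
      refine ⟨⟨_, hbij.mapsTo (hσ.matchingMap hω)⟩, ⟨σ, hσ, ha, rfl⟩, ?_⟩
      rintro b ⟨σ', hσ', ha', hb⟩
      obtain rfl := hbij.injOn hσ hσ' (ha.trans ha'.symm)
      exact Subtype.ext hb.symm
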